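/- Let $r\in(0,1)$ and let $m\ge 1$ be an integer. Put $G_{r,m}:=\{z\in\mathbb{C}:|z^m-1|<r^m\}$ and let $\mu_0$ be area measure (planar Lebesgue measure) on $G_{r,m}$. Let $\varphi_j(z;\mu_0)$, $j\ge 0$, be the orthonormal polynomials of $\mu_0$ ($\varphi_j$ has degree $j$ and positive leading coefficient, and $\int\varphi_i\overline{\varphi_j}\,d\mu_0=\delta_{i,j}$), and let $$K_n(z,w;\mu_0):=\sum_{j=0}^{n}\varphi_j(z;\mu_0)\overline{\varphi_j(w;\mu_0)}$$ be the degree $n$ polynomial reproducing kernel. For $z_0\in\partial G_{r,m}$ and $a,b\in\mathbb{C}$ put $$w_0:=\frac{z_0^m-1}{r^m},\qquad A:=\frac{\overline{w}_0\,a\,z_0^{m-1}+w_0\,\overline{b}\,\overline{z}_0^{\,m-1}}{r^m},$$ and let $$H(t):={}_1F_1(2;3;t)=\begin{cases}2\,\dfrac{e^t(t-1)+1}{t^2}, & t\ne 0,\\[1ex] 1, & t=0.\end{cases}$$ Let $J$ be a compact subset of $\partial G_{r,m}$ (for example, a closed arc of the boundary). Then, uniformly for $z_0\in J$ and for $a$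 and $b$ in compact subsets of $\mathbb{C}$, $$K_n\!\left(z_0+\frac an,\,z_0+\frac bn;\,\mu_0\right)=n^2H(A)\,\frac{|z_0|^{2m-2}}{2\pi r^{2m}}+o(n^2)\qquad\text{as } n\to\infty.$$ That is, for all compact sets $S,T\subset\mathbb{C}$ and every $\varepsilon>0$ there is $N$ such that for all $n\ge N$, $z_0\in J$, $a\in S$ and $b\in T$ the two sides differ, without the $o(n^2)$ term, by at most $\varepsilon n^2$. -/

import Mathlib

open scoped ComplexConjugate

noncomputable section

namespace OrthPoly

open MeasureTheory Polynomial

/-- The Hermitian form `⟨P, Q⟩ = ∫ P(z) * conj (Q(z)) dμ(z)` on complex polynomials. -/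
def polyInner (μ : Measure ℂ) (P Q : ℂ[X]) : ℂ := ∫ z, P.eval z * conj (Q.eval z) ∂μ

/-- The monic orthogonal polynomials `Φ_n( · ; μ)`, obtained by the Gram-Schmidt process
from `1, X, X ^ 2, …`. -/
def monicPoly (μ : Measure ℂ) (n : ℕ) : ℂ[X] :=
  X ^ n - ∑ k : Fin n,
    C (polyInner μ (X ^ n) (monicPoly μ k) / polyInner μ (monicPoly μ k) (monicPoly μ k))
      * monicPoly μ k
termination_by n
decreasing_by all_goals exact k.2

/-- The leading coefficient `κ_n(μ) = 1 / ‖Φ_n( · ; μ)‖_{L²(μ)}` of the orthonormal polynomial. -/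
def leadCoeff (μ : Measure ℂ) (n : ℕ) : ℝ :=
  (Real.sqrt (∫ z, ‖(monicPoly μ n).eval z‖ ^ 2 ∂μ))⁻¹

/-- The orthonormal polynomials `φ_n( · ; μ) = κ_n(μ) Φ_n( · ; μ)`. -/
def orthonormalPoly (μ : Measure ℂ) (n : ℕ) : ℂ[X] :=
  C (leadCoeff μ n : ℂ) * monicPoly μ n

/-- The polynomial reproducing kernel
`K_n(z, w; μ) = ∑_{j = 0}^{n} φ_j(z; μ) * conj (φ_j(w; μ))`. -/
def kernel (μ : Measure ℂ) (n : ℕ) (z w : ℂ) : ℂ :=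
  ∑ j ∈ Finset.range (n + 1), (orthonormalPoly μ j).eval z * conj ((orthonormalPoly μ j).eval w)

/-! The following facts confirm that for a finite measure with compact, infinite support the
polynomials `orthonormalPoly μ n` are the orthonormal polynomials with positive leading
coefficients. -/

theorem monicPoly_eq (μ : Measure ℂ) (n : ℕ) :
    monicPoly μ n = X ^ n - ∑ k : Fin n,
      C (polyInner μ (X ^ n) (monicPoly μ k) / polyInner μ (monicPoly μ k) (monicPoly μ k))
        * monicPoly μ k := by
  rw [monicPoly]

theorem monicPoly_monic_natDegree (μ : Measure ℂ) (n : ℕ) :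
    (monicPoly μ n).Monic ∧ (monicPoly μ n).natDegree = n := by
  induction n using Nat.strong_induction_on with
  | _ n ih =>
    rw [monicPoly_eq]
    have hlt : (∑ k : Fin n,
        C (polyInner μ (X ^ n) (monicPoly μ k) / polyInner μ (monicPoly μ k) (monicPoly μ k))
          * monicPoly μ k).degree < (X ^ n : ℂ[X]).degree := by
      rw [degree_X_pow]
      refine lt_of_le_of_lt (degree_sum_le _ _) ?_
      refine (Finset.sup_lt_iff (WithBot.bot_lt_coe n)).2 ?_
      intro k _
      rw [← smul_eq_C_mul]
      refine lt_of_le_of_lt (degree_smul_le _ _) ?_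
      rw [degree_eq_natDegree (ih k k.2).1.ne_zero, (ih k k.2).2]
      exact WithBot.coe_lt_coe.2 k.2
    refine ⟨(monic_X_pow n).sub_of_left hlt, ?_⟩
    rw [natDegree_eq_of_degree_eq (degree_sub_eq_left_of_degree_lt hlt), natDegree_X_pow]

theorem integrable_eval_mul {μ : Measure ℂ} [IsFiniteMeasure μ] {K : Set ℂ} (hK : IsCompact K)
    (hμK : μ Kᶜ = 0) (P Q : ℂ[X]) :
    Integrable (fun z => P.eval z * conj (Q.eval z)) μ := by
  have h : ContinuousOn (fun z => P.eval z * conj (Q.eval z)) K := by fun_prop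
  have h1 := h.integrableOn_compact (μ := μ) hK
  have h2 : μ.restrict K = μ := Measure.restrict_eq_self_of_ae_mem (by
    rw [ae_iff]; exact hμK)
  rwa [IntegrableOn, h2] at h1

theorem polyInner_conj (μ : Measure ℂ) (P Q : ℂ[X]) : conj (polyInner μ P Q) = polyInner μ Q P := by
  unfold polyInner
  rw [← integral_conj]
  congr 1
  ext z
  simp [mul_comm]

theorem polyInner_self (μ : Measure ℂ) (P : ℂ[X]) :
    polyInner μ P P = ((∫ z, ‖P.eval z‖ ^ 2 ∂μ : ℝ) : ℂ) := by
  unfold polyInner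
  rw [← integral_complex_ofReal]
  congr 1
  ext z
  rw [Complex.mul_conj, Complex.normSq_eq_norm_sq]

theorem polyInner_C_mul_C_mul (μ : Measure ℂ) (a b : ℂ) (P Q : ℂ[X]) :
    polyInner μ (C a * P) (C b * Q) = a * conj b * polyInner μ P Q := by
  unfold polyInner
  rw [← integral_const_mul]
  congr 1
  ext z
  simp
  ring

theorem integral_norm_sq_pos {μ : Measure ℂ} [IsFiniteMeasure μ] {K : Set ℂ} (hK : IsCompact K)
    (hμK : μ Kᶜ = 0) (hinf : ∀ S : Set ℂ, S.Finite → μ Sᶜ ≠ 0) {P : ℂ[X]} (hP : P ≠ 0) :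
    0 < ∫ z, ‖P.eval z‖ ^ 2 ∂μ := by
  have hint : Integrable (fun z => ‖P.eval z‖ ^ 2) μ := by
    have := (integrable_eval_mul hK hμK P P).norm
    refine this.congr (Filter.Eventually.of_forall fun z => ?_)
    simp [sq]
  rw [integral_pos_iff_support_of_nonneg (fun z => by positivity) hint]
  have hs : Function.support (fun z => ‖P.eval z‖ ^ 2) = {z | P.IsRoot z}ᶜ := by
    ext z
    simp [IsRoot]
  rw [hs]
  exact pos_iff_ne_zero.2 (hinf _ (finite_setOfPred_isRoot hP))

theorem polyInner_monicPoly_of_lt {μ : Measure ℂ} [IsFiniteMeasure μ] {K : Set ℂ} (hK : IsCompact K)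
    (hμK : μ Kᶜ = 0) (hinf : ∀ S : Set ℂ, S.Finite → μ Sᶜ ≠ 0) (n : ℕ) :
    ∀ k < n, polyInner μ (monicPoly μ n) (monicPoly μ k) = 0 := by
  induction n using Nat.strong_induction_on with
  | _ n ih =>
    intro k hk
    have hne : polyInner μ (monicPoly μ k) (monicPoly μ k) ≠ 0 := by
      rw [polyInner_self]
      exact_mod_cast (integral_norm_sq_pos hK hμK hinf
        (monicPoly_monic_natDegree μ k).1.ne_zero).ne'
    have hexp : polyInner μ (monicPoly μ n) (monicPoly μ k) = polyInner μ (X ^ n) (monicPoly μ k)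
        - ∑ j : Fin n, (polyInner μ (X ^ n) (monicPoly μ j)
            / polyInner μ (monicPoly μ j) (monicPoly μ j))
          * polyInner μ (monicPoly μ j) (monicPoly μ k) := by
      rw [monicPoly_eq μ n]
      simp only [polyInner]
      simp only [eval_sub, eval_finsetSum, eval_mul, eval_C, sub_mul, Finset.sum_mul, mul_assoc]
      rw [integral_sub (integrable_eval_mul hK hμK _ _)
        (integrable_finsetSum _ fun j _ => (integrable_eval_mul hK hμK _ _).const_mul _),
        integral_finsetSum _ fun j _ => (integrable_eval_mul hK hμK _ _).const_mul _]
      simp only [integral_const_mul]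
    rw [hexp, Finset.sum_eq_single (⟨k, hk⟩ : Fin n), div_mul_cancel₀ _ hne, sub_self]
    · intro j _ hj
      have hjk : (j : ℕ) ≠ k := fun h => hj (Fin.ext h)
      rcases lt_or_gt_of_ne hjk with h | h
      · rw [← polyInner_conj μ (monicPoly μ k) (monicPoly μ j), ih k hk j h, map_zero, mul_zero]
      · rw [ih j j.2 k h, mul_zero]
    · simp

/-- The polynomials `φ_n` have degree `n`, positive leading coefficient `κ_n`, and are
orthonormal in `L²(μ)`. -/
theorem orthonormalPoly_spec {μ : Measure ℂ} [IsFiniteMeasure μ] {K : Set ℂ} (hK : IsCompact K)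
    (hμK : μ Kᶜ = 0) (hinf : ∀ S : Set ℂ, S.Finite → μ Sᶜ ≠ 0) :
    (∀ n, (orthonormalPoly μ n).natDegree = n ∧
      (orthonormalPoly μ n).leadingCoeff = (leadCoeff μ n : ℂ) ∧ 0 < leadCoeff μ n) ∧
    ∀ m n, ∫ z, (orthonormalPoly μ n).eval z * conj ((orthonormalPoly μ m).eval z) ∂μ
      = if m = n then 1 else 0 := by
  have hpos : ∀ n, 0 < ∫ z, ‖(monicPoly μ n).eval z‖ ^ 2 ∂μ := fun n =>
    integral_norm_sq_pos hK hμK hinf (monicPoly_monic_natDegree μ n).1.ne_zero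
  have hl : ∀ n, 0 < leadCoeff μ n := fun n => inv_pos.2 (Real.sqrt_pos.2 (hpos n))
  refine ⟨fun n => ⟨?_, ?_, hl n⟩, fun m n => ?_⟩
  · rw [orthonormalPoly, natDegree_C_mul (by exact_mod_cast (hl n).ne'),
      (monicPoly_monic_natDegree μ n).2]
  · rw [orthonormalPoly, leadingCoeff_mul, leadingCoeff_C,
      (monicPoly_monic_natDegree μ n).1.leadingCoeff, mul_one]
  · change polyInner μ (orthonormalPoly μ n) (orthonormalPoly μ m) = _
    rw [orthonormalPoly, orthonormalPoly, polyInner_C_mul_C_mul]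
    split_ifs with h
    · subst h
      rw [polyInner_self, Complex.conj_ofReal, leadCoeff]
      norm_cast
      have h2 := Real.mul_self_sqrt (hpos m).le
      have h3 := (Real.sqrt_pos.2 (hpos m)).ne'
      nth_rewrite 3 [← h2]
      field_simp
    · rcases lt_or_gt_of_ne h with h | h
      · rw [polyInner_monicPoly_of_lt hK hμK hinf n m h, mul_zero]
      · rw [← polyInner_conj, polyInner_monicPoly_of_lt hK hμK hinf m n h, map_zero, mul_zero]

end OrthPoly

namespace Lemniscate

open MeasureTheory

/-- The region `G_{r,m} = {z : |z ^ m - 1| < r ^ m}`. -/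
def region (r : ℝ) (m : ℕ) : Set ℂ := {z | ‖z ^ m - 1‖ < r ^ m}

/-- Area measure `μ₀` on `G_{r,m}`. -/
def areaMeasure (r : ℝ) (m : ℕ) : Measure ℂ := volume.restrict (region r m)

/-- The function `H(t) = ₁F₁(2; 3; t)` in closed form. -/
def H (t : ℂ) : ℂ := if t = 0 then 1 else 2 * ((Complex.exp t * (t - 1) + 1) / t ^ 2)

/-- The point `w₀ = (z₀ ^ m - 1) / r ^ m`, on the unit circle when `z₀ ∈ ∂G_{r,m}`. -/
def w₀ (r : ℝ) (m : ℕ) (z₀ : ℂ) : ℂ := (z₀ ^ m - 1) / (r : ℂ) ^ m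

/-- `A = (conj w₀ * a * z₀ ^ (m - 1) + w₀ * conj b * conj z₀ ^ (m - 1)) / r ^ m`, for `m ≥ 1`. -/
def A (r : ℝ) (m : ℕ) (z₀ a b : ℂ) : ℂ :=
  (conj (w₀ r m z₀) * a * z₀ ^ (m - 1) + w₀ r m z₀ * conj b * conj z₀ ^ (m - 1)) / (r : ℂ) ^ m

end Lemniscate

end

/-!
The kernel `K_n` is compared with a model kernel for which the limit can be read off.

The set `|z ^ m - 1| < ρ`, `ρ = r ^ m < 1`, splits into `m` sheets, one for each `m`-th root of
unity `ζ` (`branch`, `sheet`), and `z ↦ z ^ m` maps every sheet conformally onto the disk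
`|u - 1| < ρ` (`integral_sheet`). On the disk the monomials `((u - 1) / ρ) ^ k` are orthogonal, so
the kernel `diskKernel` of the polynomials of degree less than `N` is an explicit sum; `modelKernel`
is its pull-back to a sheet. With `N = n / m + O(1)` and points at distance `O(1 / n)` from a
boundary point, the sum is a Riemann sum for `∫ t in 0..1, t * exp (A * t) = H A / 2`, which gives
the limit of the model kernel, uniformly (`isBigO_modelKernel_sub`).

The link between the two kernels is that the indicator function of a sheet is a uniform limit of
polynomials, even on the larger set `|z ^ m - 1| ≤ s` with `ρ < s < 1`
(`exists_polynomial_near_indicator`): by a finite Fourier sum the indicator is a combination of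
the functions `z ^ l * (z ^ m) ^ (-l / m)`, and the powers of `u = z ^ m` in them have Taylor
series at `1` that converge uniformly on `|u - 1| ≤ s`. The degree of the approximating
polynomials depends on the accuracy `η` but not on `n`, so it does not affect the leading order.

* Upper bound on the diagonal (`kernel_self_le`). Multiply a polynomial `P` of degree at most `n` by
  an approximate indicator of the sheet of `w`, divided by `z ^ (m - 1)`, and sum over the rotations
  by `m`-th roots of unity. The result is `f (z ^ m)` with `deg f ≤ n / m + O(1)`, and
  `z ^ (m - 1) * f (z ^ m)` is close to `P` on that sheet, so the extremal property of the disk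
  kernel bounds `|P w|`.
* Lower bound (`exists_polynomial_near_modelKernel`). The model kernel times an approximate
  indicator is a polynomial of degree at most `n` whose values are near the model kernel on the
  sheet and whose norm is not much larger than that of the model kernel.

A polynomial `P` of degree at most `n` satisfies
`|K_n(z, w) - P z| ^ 2 ≤ K_n(z, z) * (K_n(w, w) - 2 * re (P w) + ‖P‖ ^ 2)`
(`OrthPoly.norm_sq_kernel_sub_eval_le`). For the polynomial of the lower bound, the last factor is
at most a multiple of `η * n ^ 2` by the upper bound, which transfers the limit from the model kernel
to `K_n`, off the diagonal as well.
-/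

/-! ### Extremal properties of the polynomial reproducing kernel -/

namespace OrthPoly

open MeasureTheory Polynomial

variable {μ : Measure ℂ} [IsFiniteMeasure μ] {K : Set ℂ}

theorem exists_eq_sum_orthonormalPoly (hK : IsCompact K) (hμK : μ Kᶜ = 0)
    (hinf : ∀ S : Set ℂ, S.Finite → μ Sᶜ ≠ 0) (n : ℕ) (P : ℂ[X]) (hP : P.degree < n) :
    ∃ c : ℕ → ℂ, P = ∑ j ∈ Finset.range n, C (c j) * orthonormalPoly μ j := by
  have hspec := (orthonormalPoly_spec hK hμK hinf).1
  induction n generalizing P with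
  | zero =>
    refine ⟨0, ?_⟩
    have : P = 0 := by simpa using hP
    simp [this]
  | succ n ih =>
    obtain ⟨hdeg, hlead, hpos⟩ := hspec n
    have hne : (leadCoeff μ n : ℂ) ≠ 0 := by exact_mod_cast hpos.ne'
    have hcoeff : (orthonormalPoly μ n).coeff n = (leadCoeff μ n : ℂ) := by
      rw [← hlead, leadingCoeff, hdeg]
    have hlt : (P - C (P.coeff n / leadCoeff μ n) * orthonormalPoly μ n).degree < n := by
      rw [degree_lt_iff_coeff_zero]
      intro k hk
      rcases hk.eq_or_lt with rfl | hk
      · rw [coeff_sub, coeff_C_mul, hcoeff, div_mul_cancel₀ _ hne, sub_self]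
      · rw [coeff_sub, coeff_C_mul, coeff_eq_zero_of_natDegree_lt (hdeg.trans_lt hk),
          (degree_lt_iff_coeff_zero P (n + 1)).1 hP k hk, mul_zero, sub_zero]
    obtain ⟨c, hc⟩ := ih _ hlt
    refine ⟨Function.update c n (P.coeff n / leadCoeff μ n), ?_⟩
    rw [Finset.sum_range_succ, Function.update_self]
    have : ∑ j ∈ Finset.range n,
        C (Function.update c n (P.coeff n / leadCoeff μ n) j) * orthonormalPoly μ j =
        ∑ j ∈ Finset.range n, C (c j) * orthonormalPoly μ j := by
      refine Finset.sum_congr rfl fun j hj => ?_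
      rw [Function.update_of_ne (Finset.mem_range.1 hj).ne]
    rw [this, ← hc, sub_add_cancel]

theorem integral_norm_sq_sum_orthonormalPoly (hK : IsCompact K) (hμK : μ Kᶜ = 0)
    (hinf : ∀ S : Set ℂ, S.Finite → μ Sᶜ ≠ 0) (n : ℕ) (c : ℕ → ℂ) :
    ∫ z, ‖(∑ j ∈ Finset.range n, C (c j) * orthonormalPoly μ j).eval z‖ ^ 2 ∂μ
      = ∑ j ∈ Finset.range n, ‖c j‖ ^ 2 := by
  have h2 := (orthonormalPoly_spec hK hμK hinf).2
  have hint := fun i j => integrable_eval_mul hK hμK (orthonormalPoly μ i) (orthonormalPoly μ j)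
  have key : polyInner μ (∑ j ∈ Finset.range n, C (c j) * orthonormalPoly μ j)
      (∑ j ∈ Finset.range n, C (c j) * orthonormalPoly μ j)
      = ∑ j ∈ Finset.range n, ((‖c j‖ ^ 2 : ℝ) : ℂ) := by
    have : ∀ z, (∑ j ∈ Finset.range n, C (c j) * orthonormalPoly μ j).eval z *
        conj ((∑ j ∈ Finset.range n, C (c j) * orthonormalPoly μ j).eval z) =
        ∑ i ∈ Finset.range n, ∑ j ∈ Finset.range n, c i * conj (c j) *
          ((orthonormalPoly μ i).eval z * conj ((orthonormalPoly μ j).eval z)) := by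
      intro z
      simp only [eval_finsetSum, eval_mul, eval_C, map_sum, map_mul, Finset.sum_mul_sum]
      exact Finset.sum_congr rfl fun i _ => Finset.sum_congr rfl fun j _ => by ring
    rw [polyInner, integral_congr_ae (Filter.Eventually.of_forall this),
      integral_finsetSum _ fun i _ => integrable_finsetSum _ fun j _ => (hint i j).const_mul _]
    refine Finset.sum_congr rfl fun i hi => ?_
    rw [integral_finsetSum _ fun j _ => (hint i j).const_mul _]
    simp only [integral_const_mul, h2]
    simp [Complex.mul_conj, Complex.normSq_eq_norm_sq, Finset.mem_range.1 hi]
  rw [polyInner_self] at key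
  exact_mod_cast key

theorem kernel_self_eq (μ : Measure ℂ) (n : ℕ) (z : ℂ) :
    kernel μ n z z =
      ((∑ j ∈ Finset.range (n + 1), ‖(orthonormalPoly μ j).eval z‖ ^ 2 : ℝ) : ℂ) := by
  simp [kernel, Complex.mul_conj, Complex.normSq_eq_norm_sq]

theorem kernel_self_re (μ : Measure ℂ) (n : ℕ) (z : ℂ) :
    (kernel μ n z z).re = ∑ j ∈ Finset.range (n + 1), ‖(orthonormalPoly μ j).eval z‖ ^ 2 := by
  rw [kernel_self_eq, Complex.ofReal_re]

theorem kernel_self_re_nonneg (μ : Measure ℂ) (n : ℕ) (z : ℂ) : 0 ≤ (kernel μ n z z).re := by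
  rw [kernel_self_re]; positivity

/-- Point evaluation on polynomials of degree at most `n` has squared norm at most
`K_n(z, z; μ)`. -/
theorem norm_sq_eval_le (hK : IsCompact K) (hμK : μ Kᶜ = 0)
    (hinf : ∀ S : Set ℂ, S.Finite → μ Sᶜ ≠ 0) {n : ℕ} {P : ℂ[X]} (hP : P.natDegree ≤ n) (z : ℂ) :
    ‖P.eval z‖ ^ 2 ≤ (kernel μ n z z).re * ∫ x, ‖P.eval x‖ ^ 2 ∂μ := by
  obtain ⟨c, rfl⟩ := exists_eq_sum_orthonormalPoly hK hμK hinf (n + 1) P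
    ((degree_le_of_natDegree_le hP).trans_lt (by exact_mod_cast n.lt_succ_self))
  rw [integral_norm_sq_sum_orthonormalPoly hK hμK hinf, kernel_self_re, mul_comm]
  simp only [eval_finsetSum, eval_mul, eval_C]
  refine (pow_le_pow_left₀ (norm_nonneg _) (norm_sum_le _ _) 2).trans ?_
  simp only [norm_mul]
  exact Finset.sum_mul_sq_le_sq_mul_sq _ _ _

/-- The polynomial `z ↦ K_n(z, w; μ)`. -/
noncomputable def kernelPoly (μ : Measure ℂ) (n : ℕ) (w : ℂ) : ℂ[X] :=
  ∑ j ∈ Finset.range (n + 1), C (conj ((orthonormalPoly μ j).eval w)) * orthonormalPoly μ j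

theorem eval_kernelPoly (μ : Measure ℂ) (n : ℕ) (z w : ℂ) :
    (kernelPoly μ n w).eval z = kernel μ n z w := by
  simp [kernelPoly, kernel, eval_finsetSum, mul_comm]

theorem natDegree_kernelPoly_le (μ : Measure ℂ) (n : ℕ) (w : ℂ) :
    (kernelPoly μ n w).natDegree ≤ n := by
  refine natDegree_sum_le_of_forall_le _ _ fun j hj => ?_
  refine (natDegree_C_mul_le _ _).trans ((natDegree_C_mul_le _ _).trans ?_)
  rw [(monicPoly_monic_natDegree μ j).2]
  exact Nat.lt_succ_iff.1 (Finset.mem_range.1 hj)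

theorem integral_norm_sq_kernelPoly (hK : IsCompact K) (hμK : μ Kᶜ = 0)
    (hinf : ∀ S : Set ℂ, S.Finite → μ Sᶜ ≠ 0) (n : ℕ) (w : ℂ) :
    ∫ z, ‖(kernelPoly μ n w).eval z‖ ^ 2 ∂μ = (kernel μ n w w).re := by
  rw [kernelPoly, integral_norm_sq_sum_orthonormalPoly hK hμK hinf, kernel_self_re]
  simp

theorem integral_norm_sq_kernelPoly_sub (hK : IsCompact K) (hμK : μ Kᶜ = 0)
    (hinf : ∀ S : Set ℂ, S.Finite → μ Sᶜ ≠ 0) {n : ℕ} {P : ℂ[X]} (hP : P.natDegree ≤ n) (w : ℂ) :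
    ∫ z, ‖(kernelPoly μ n w - P).eval z‖ ^ 2 ∂μ
      = (kernel μ n w w).re - 2 * (P.eval w).re + ∫ z, ‖P.eval z‖ ^ 2 ∂μ := by
  obtain ⟨c, rfl⟩ := exists_eq_sum_orthonormalPoly hK hμK hinf (n + 1) P
    ((degree_le_of_natDegree_le hP).trans_lt (by exact_mod_cast n.lt_succ_self))
  have h1 : kernelPoly μ n w - ∑ j ∈ Finset.range (n + 1), C (c j) * orthonormalPoly μ j =
      ∑ j ∈ Finset.range (n + 1),
        C (conj ((orthonormalPoly μ j).eval w) - c j) * orthonormalPoly μ j := by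
    rw [kernelPoly, ← Finset.sum_sub_distrib]
    exact Finset.sum_congr rfl fun j _ => by rw [C_sub]; ring
  rw [h1, integral_norm_sq_sum_orthonormalPoly hK hμK hinf,
    integral_norm_sq_sum_orthonormalPoly hK hμK hinf, kernel_self_re, eval_finsetSum,
    Complex.re_sum, Finset.mul_sum, ← Finset.sum_sub_distrib, ← Finset.sum_add_distrib]
  refine Finset.sum_congr rfl fun j _ => ?_
  simp only [Complex.sq_norm, Complex.normSq_apply, eval_mul, eval_C, Complex.mul_re,
    Complex.sub_re, Complex.sub_im, Complex.conj_re, Complex.conj_im]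
  ring

/-- A polynomial `P` whose squared norm and value at `w` are both close to `K_n(w, w; μ)` is close
to `K_n(·, w; μ)`. -/
theorem norm_sq_kernel_sub_eval_le (hK : IsCompact K) (hμK : μ Kᶜ = 0)
    (hinf : ∀ S : Set ℂ, S.Finite → μ Sᶜ ≠ 0) {n : ℕ} {P : ℂ[X]} (hP : P.natDegree ≤ n)
    (z w : ℂ) :
    ‖kernel μ n z w - P.eval z‖ ^ 2 ≤ (kernel μ n z z).re *
      ((kernel μ n w w).re - 2 * (P.eval w).re + ∫ x, ‖P.eval x‖ ^ 2 ∂μ) := by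
  have hdeg : (kernelPoly μ n w - P).natDegree ≤ n :=
    (natDegree_sub_le _ _).trans (max_le (natDegree_kernelPoly_le μ n w) hP)
  have := norm_sq_eval_le hK hμK hinf hdeg z
  rwa [integral_norm_sq_kernelPoly_sub hK hμK hinf hP, eval_sub, eval_kernelPoly] at this

end OrthPoly

namespace Lemniscate

open MeasureTheory Polynomial Filter Asymptotics Topology

/-! ### The reproducing kernel of polynomials on a disk -/

theorem setIntegral_comp_unit_mul {E : Type*} [NormedAddCommGroup E] [NormedSpace ℝ E] {a : ℂ}
    (ha : ‖a‖ = 1) {s : Set ℂ} (hs : ∀ z, a * z ∈ s ↔ z ∈ s) (f : ℂ → E) :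
    ∫ u in s, f (a * u) = ∫ u in s, f u := by
  have h := (rotation (⟨a, by simp [Submonoid.unitSphere, ha]⟩ : Circle)).measurePreserving
  have := h.setIntegral_preimage_emb (MeasurableEquiv.measurableEmbedding
    (rotation (⟨a, by simp [Submonoid.unitSphere, ha]⟩ : Circle)).toHomeomorph.toMeasurableEquiv)
    f s
  rw [← this]
  congr 2
  ext u
  exact (hs u).symm

theorem integral_ball_pow_mul_conj_pow {ρ : ℝ} (hρ : 0 < ρ) (j k : ℕ) :
    ∫ u in Metric.ball (0 : ℂ) ρ, (u / ρ) ^ j * conj ((u / ρ) ^ k)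
      = if j = k then (Real.pi * ρ ^ 2 / (k + 1) : ℂ) else 0 := by
  split_ifs with hjk
  · subst hjk
    have h1 : ∀ u : ℂ, (u / ρ) ^ j * conj ((u / ρ) ^ j) = (((‖u‖ / ρ) ^ (2 * j) : ℝ) : ℂ) := by
      intro u
      rw [Complex.mul_conj, Complex.normSq_eq_norm_sq]
      simp [pow_mul', abs_of_pos hρ]
    simp only [h1]
    rw [integral_complex_ofReal, ← integral_indicator Metric.isOpen_ball.measurableSet]
    have h2 : (Metric.ball (0 : ℂ) ρ).indicator (fun u => (‖u‖ / ρ) ^ (2 * j)) =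
        fun u => (fun x : ℝ => if x < ρ then (x / ρ) ^ (2 * j) else 0) ‖u‖ := by
      ext u
      by_cases h : ‖u‖ < ρ <;> simp [h]
    rw [h2, integral_fun_norm_addHaar]
    have h3 : ∫ y in Set.Ioi (0 : ℝ), y ^ (Module.finrank ℝ ℂ - 1) •
        (if y < ρ then (y / ρ) ^ (2 * j) else 0) = ρ ^ 2 / (2 * j + 2) := by
      have : ∀ y : ℝ, y ^ (Module.finrank ℝ ℂ - 1) •
        (if y < ρ then (y / ρ) ^ (2 * j) else 0) =
          (Set.Iio ρ).indicator (fun y => y ^ (2 * j + 1) / ρ ^ (2 * j)) y := by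
        intro y
        by_cases h : y < ρ
        · simp [h, div_pow]; ring
        · simp [h]
      simp only [this]
      rw [setIntegral_indicator measurableSet_Iio, Set.Ioi_inter_Iio,
        ← integral_Ioc_eq_integral_Ioo,
        ← intervalIntegral.integral_of_le hρ.le, intervalIntegral.integral_div, integral_pow]
      push_cast
      field_simp
      ring
    rw [h3]
    simp [Measure.real, Complex.volume_ball]
    field_simp
  · set I := ∫ u in Metric.ball (0 : ℂ) ρ, (u / ρ) ^ j * conj ((u / ρ) ^ k) with hI
    have hd : ((j : ℂ) - k) ≠ 0 := sub_ne_zero.2 (by exact_mod_cast hjk)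
    -- A rotation under which the integrand changes sign.
    set θ : ℝ := Real.pi / (j - k)
    set a : ℂ := Complex.exp (θ * Complex.I) with ha
    have ha1 : ‖a‖ = 1 := Complex.norm_exp_ofReal_mul_I θ
    have hsign : a ^ j * conj (a ^ k) = -1 := by
      rw [ha, ← Complex.exp_nat_mul, ← Complex.exp_nat_mul, ← Complex.exp_conj, ← Complex.exp_add,
        ← Complex.exp_pi_mul_I]
      congr 1
      simp [θ]
      field_simp
      ring
    have := setIntegral_comp_unit_mul ha1 (s := Metric.ball 0 ρ)
      (by simp [ha1]) (fun u => (u / ρ) ^ j * conj ((u / ρ) ^ k))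
    have h2 : ∀ u : ℂ, (a * u / ρ) ^ j * conj ((a * u / ρ) ^ k) =
        -((u / ρ) ^ j * conj ((u / ρ) ^ k)) := by
      intro u
      rw [mul_div_assoc, mul_pow, mul_pow, map_mul, mul_mul_mul_comm, hsign, neg_one_mul]
    simp only [h2, integral_neg] at this
    rw [← hI] at this
    have h3 : (2 : ℂ) * I = 0 := by linear_combination -this
    simpa using h3

theorem integrableOn_ball_of_continuous {E : Type*} [NormedAddCommGroup E] {f : ℂ → E}
    (hf : Continuous f) (c : ℂ) (ρ : ℝ) : IntegrableOn f (Metric.ball c ρ) :=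
  (hf.continuousOn.integrableOn_compact (isCompact_closedBall c ρ)).mono_set
    Metric.ball_subset_closedBall

/-- Parseval's identity for polynomials on a disk. -/
theorem integral_ball_norm_sq_sum {ρ : ℝ} (hρ : 0 < ρ) (N : ℕ) (c : ℕ → ℂ) :
    ∫ u in Metric.ball (1 : ℂ) ρ, ‖∑ k ∈ Finset.range N, c k * ((u - 1) / ρ) ^ k‖ ^ 2
      = ∑ k ∈ Finset.range N, ‖c k‖ ^ 2 * (Real.pi * ρ ^ 2 / (k + 1)) := by
  have hshift : ∫ u in Metric.ball (1 : ℂ) ρ, ‖∑ k ∈ Finset.range N, c k * ((u - 1) / ρ) ^ k‖ ^ 2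
      = ∫ u in Metric.ball (0 : ℂ) ρ, ‖∑ k ∈ Finset.range N, c k * (u / ρ) ^ k‖ ^ 2 := by
    have h := measurePreserving_add_right (volume : Measure ℂ) (1 : ℂ)
    have := h.setIntegral_preimage_emb (measurableEmbedding_addRight 1)
      (fun u => ‖∑ k ∈ Finset.range N, c k * ((u - 1) / ρ) ^ k‖ ^ 2) (Metric.ball 1 ρ)
    rw [← this]
    simp only [add_sub_cancel_right]
    congr 2
    ext u
    simp [dist_eq_norm]
  rw [hshift]
  have hint : ∀ i j : ℕ, IntegrableOn (fun u : ℂ => (u / ρ) ^ i * conj ((u / ρ) ^ j))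
      (Metric.ball 0 ρ) := fun i j => integrableOn_ball_of_continuous (by fun_prop) _ _
  have key : ∫ u in Metric.ball (0 : ℂ) ρ, ((∑ k ∈ Finset.range N, c k * (u / ρ) ^ k) *
      conj (∑ k ∈ Finset.range N, c k * (u / ρ) ^ k)) =
      ((∑ k ∈ Finset.range N, ‖c k‖ ^ 2 * (Real.pi * ρ ^ 2 / (k + 1)) : ℝ) : ℂ) := by
    have : ∀ u : ℂ, (∑ k ∈ Finset.range N, c k * (u / ρ) ^ k) *
      conj (∑ k ∈ Finset.range N, c k * (u / ρ) ^ k) =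
        ∑ i ∈ Finset.range N, ∑ j ∈ Finset.range N, c i * conj (c j) *
          ((u / ρ) ^ i * conj ((u / ρ) ^ j)) := by
      intro u
      rw [map_sum, Finset.sum_mul_sum]
      refine Finset.sum_congr rfl fun i _ => Finset.sum_congr rfl fun j _ => ?_
      rw [map_mul]
      ring
    simp only [this]
    rw [integral_finsetSum _ fun i _ => integrable_finsetSum _ fun j _ => (hint i j).const_mul _]
    push_cast
    refine Finset.sum_congr rfl fun i hi => ?_
    rw [integral_finsetSum _ fun j _ => (hint i j).const_mul _]
    simp only [integral_const_mul, integral_ball_pow_mul_conj_pow hρ]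
    simp [Complex.mul_conj, Complex.normSq_eq_norm_sq, Finset.mem_range.1 hi]
  have h2 : ∀ u : ℂ, (∑ k ∈ Finset.range N, c k * (u / ρ) ^ k) *
      conj (∑ k ∈ Finset.range N, c k * (u / ρ) ^ k) =
      ((‖∑ k ∈ Finset.range N, c k * (u / ρ) ^ k‖ ^ 2 : ℝ) : ℂ) := fun u => by
    rw [Complex.mul_conj, Complex.normSq_eq_norm_sq]
  simp only [h2] at key
  rw [integral_complex_ofReal] at key
  exact_mod_cast key

/-- The reproducing kernel of the polynomials of degree less than `N` on the disk
`|u - 1| < ρ` with area measure. -/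
noncomputable def diskKernel (ρ : ℝ) (N : ℕ) (u v : ℂ) : ℂ :=
  ∑ k ∈ Finset.range N, ((k + 1) / (Real.pi * ρ ^ 2) : ℂ) *
    ((u - 1) / ρ * conj ((v - 1) / ρ)) ^ k

theorem diskKernel_self (ρ : ℝ) (N : ℕ) (v : ℂ) :
    diskKernel ρ N v v = ((∑ k ∈ Finset.range N, ((k + 1) / (Real.pi * ρ ^ 2)) *
      (‖(v - 1) / ρ‖ ^ k) ^ 2 : ℝ) : ℂ) := by
  rw [diskKernel]
  push_cast
  refine Finset.sum_congr rfl fun k _ => ?_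
  rw [Complex.mul_conj, Complex.normSq_eq_norm_sq]
  push_cast
  ring

theorem diskKernel_self_re_nonneg (ρ : ℝ) (N : ℕ) (v : ℂ) : 0 ≤ (diskKernel ρ N v v).re := by
  rw [diskKernel_self, Complex.ofReal_re]
  positivity

theorem integral_ball_norm_sq_diskKernel {ρ : ℝ} (hρ : 0 < ρ) (N : ℕ) (v : ℂ) :
    ∫ u in Metric.ball (1 : ℂ) ρ, ‖diskKernel ρ N u v‖ ^ 2 = (diskKernel ρ N v v).re := by
  have h : ∀ u, diskKernel ρ N u v = ∑ k ∈ Finset.range N,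
      (((k + 1) / (Real.pi * ρ ^ 2) : ℂ) * conj ((v - 1) / ρ) ^ k) * ((u - 1) / ρ) ^ k := by
    intro u
    refine Finset.sum_congr rfl fun k _ => ?_
    rw [mul_pow]
    ring
  simp only [h]
  rw [integral_ball_norm_sq_sum hρ, ← h, diskKernel_self, Complex.ofReal_re]
  refine Finset.sum_congr rfl fun k _ => ?_
  have h1 : ‖(((k : ℂ) + 1) / (Real.pi * ρ ^ 2))‖ = (k + 1) / (Real.pi * ρ ^ 2) := by
    have : (((k : ℂ) + 1) / (Real.pi * ρ ^ 2)) = (((k + 1) / (Real.pi * ρ ^ 2) : ℝ) : ℂ) := by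
      push_cast; rfl
    rw [this, Complex.norm_real, Real.norm_of_nonneg (by positivity)]
  rw [norm_mul, h1, norm_pow, RCLike.norm_conj]
  have := Real.pi_pos
  field_simp

/-- The extremal property of the disk kernel. -/
theorem norm_sq_eval_le_diskKernel {ρ : ℝ} (hρ : 0 < ρ) {N : ℕ} {f : ℂ[X]} (hf : f.natDegree < N)
    (v : ℂ) :
    ‖f.eval v‖ ^ 2 ≤ (diskKernel ρ N v v).re * ∫ u in Metric.ball (1 : ℂ) ρ, ‖f.eval u‖ ^ 2 := by
  -- Expand `f` in powers of `(u - 1) / ρ`.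
  set g : ℂ[X] := f.comp (C (ρ : ℂ) * X + C 1)
  have hρ' : (ρ : ℂ) ≠ 0 := by exact_mod_cast hρ.ne'
  have hg : g.natDegree < N := by
    refine lt_of_le_of_lt natDegree_comp_le (lt_of_le_of_lt ?_ hf)
    exact mul_le_of_le_one_right' natDegree_linear_le
  have hfe : ∀ u, f.eval u = ∑ k ∈ Finset.range N, g.coeff k * ((u - 1) / ρ) ^ k := by
    intro u
    rw [← eval_eq_sum_range' hg, eval_comp]
    congr 1
    simp
    field_simp
    ring
  simp only [hfe]
  rw [integral_ball_norm_sq_sum hρ, diskKernel_self, Complex.ofReal_re, mul_comm]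
  refine (pow_le_pow_left₀ (norm_nonneg _) (norm_sum_le _ _) 2).trans ?_
  have hpos : ∀ k : ℕ, 0 < Real.pi * ρ ^ 2 / ((k : ℝ) + 1) := fun k => by
    have := Real.pi_pos
    positivity
  refine Finset.sum_sq_le_sum_mul_sum_of_sq_le_mul _ (fun k _ => ?_) (fun k _ => ?_) fun k _ => ?_
  · positivity
  · positivity
  · have := Real.pi_pos
    refine le_of_eq ?_
    rw [norm_mul, norm_pow]
    field_simp

/-! ### Sheets of the map `z ↦ z ^ m` -/

/-- For `|z ^ m - 1| < 1`, the `m`-th root of unity `ζ` such that `z` is `ζ` times the principal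
`m`-th root of `z ^ m`. It labels the component of the set `|z ^ m - 1| < 1` that contains `z`. -/
noncomputable def branch (m : ℕ) (z : ℂ) : ℂ := z / (z ^ m) ^ ((m : ℂ)⁻¹)

theorem ne_zero_of_norm_sub_one_lt {u : ℂ} (hu : ‖u - 1‖ < 1) : u ≠ 0 := by
  rintro rfl
  simp at hu

theorem branch_pow {m : ℕ} (hm : m ≠ 0) {z : ℂ} (hz : ‖z ^ m - 1‖ < 1) : branch m z ^ m = 1 := by
  rw [branch, div_pow, Complex.cpow_nat_inv_pow _ hm, div_self (ne_zero_of_norm_sub_one_lt hz)]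

theorem branch_mul_root {m : ℕ} {z : ℂ} (hz : ‖z ^ m - 1‖ < 1) :
    branch m z * (z ^ m) ^ ((m : ℂ)⁻¹) = z := by
  refine div_mul_cancel₀ _ ?_
  rw [Complex.cpow_ne_zero_iff]
  exact Or.inl (ne_zero_of_norm_sub_one_lt hz)

theorem branch_mul {m : ℕ} {ζ : ℂ} (hζ : ζ ^ m = 1) (z : ℂ) :
    branch m (ζ * z) = ζ * branch m z := by
  rw [branch, branch, mul_pow, hζ, one_mul, mul_div_assoc]

theorem measurable_branch (m : ℕ) : Measurable (branch m) := by
  unfold branch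
  exact measurable_id.div ((measurable_id.pow_const m).pow_const _)

/-- The part of the set `|z ^ m - 1| < ρ` on which `branch m` is equal to `ζ`. -/
def sheet (ρ : ℝ) (m : ℕ) (ζ : ℂ) : Set ℂ := {z | ‖z ^ m - 1‖ < ρ ∧ branch m z = ζ}

theorem measurableSet_sheet (ρ : ℝ) (m : ℕ) (ζ : ℂ) : MeasurableSet (sheet ρ m ζ) := by
  have h : IsOpen {z : ℂ | ‖z ^ m - 1‖ < ρ} := isOpen_lt (by fun_prop) continuous_const
  exact h.measurableSet.inter (measurable_branch m (measurableSet_singleton ζ))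

theorem image_pow_sheet {ρ : ℝ} (hρ : ρ ≤ 1) {m : ℕ} (hm : m ≠ 0) {ζ : ℂ} (hζ : ζ ^ m = 1) :
    (fun z : ℂ => z ^ m) '' sheet ρ m ζ = Metric.ball 1 ρ := by
  ext u
  rw [Metric.mem_ball, dist_eq_norm]
  constructor
  · rintro ⟨z, hz, rfl⟩
    exact hz.1
  · intro hu
    have hpow : (ζ * u ^ ((m : ℂ)⁻¹)) ^ m = u := by
      rw [mul_pow, hζ, one_mul, Complex.cpow_nat_inv_pow _ hm]
    refine ⟨ζ * u ^ ((m : ℂ)⁻¹), ⟨by rwa [hpow], ?_⟩, hpow⟩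
    rw [branch, hpow]
    refine mul_div_cancel_right₀ _ ?_
    rw [Complex.cpow_ne_zero_iff]
    exact Or.inl (ne_zero_of_norm_sub_one_lt (hu.trans_le hρ))

theorem injOn_pow_sheet {ρ : ℝ} (hρ : ρ ≤ 1) (m : ℕ) (ζ : ℂ) :
    Set.InjOn (fun z : ℂ => z ^ m) (sheet ρ m ζ) := by
  intro z hz w hw h
  rw [← branch_mul_root (hz.1.trans_le hρ), ← branch_mul_root (hw.1.trans_le hρ), hz.2, hw.2]
  simp only at h
  rw [h]

/-- The real Jacobian of multiplication by `c`. -/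
theorem abs_det_restrictScalars_smulRight (c : ℂ) :
    |(((1 : ℂ →L[ℂ] ℂ).smulRight c).restrictScalars ℝ).det| = ‖c‖ ^ 2 := by
  have : (((1 : ℂ →L[ℂ] ℂ).smulRight c).restrictScalars ℝ).det
      = LinearMap.det (((1 : ℂ →L[ℂ] ℂ).smulRight c : ℂ →ₗ[ℂ] ℂ).restrictScalars ℝ) := rfl
  rw [this, LinearMap.det_restrictScalars, Algebra.norm_complex_apply, LinearMap.det_ring]
  simp [Complex.normSq_eq_norm_sq]

/-- Each sheet is mapped conformally onto the disk `|u - 1| < ρ` by `z ↦ z ^ m`. -/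
theorem integral_sheet {ρ : ℝ} (hρ : ρ ≤ 1) {m : ℕ} (hm : m ≠ 0) {ζ : ℂ} (hζ : ζ ^ m = 1)
    (F : ℂ → ℝ) :
    ∫ z in sheet ρ m ζ, ‖(m : ℂ) * z ^ (m - 1)‖ ^ 2 * F (z ^ m)
      = ∫ u in Metric.ball (1 : ℂ) ρ, F u := by
  rw [← image_pow_sheet hρ hm hζ, integral_image_eq_integral_abs_det_fderiv_smul volume
    (measurableSet_sheet ρ m ζ)
    (f' := fun z => ((1 : ℂ →L[ℂ] ℂ).smulRight ((m : ℂ) * z ^ (m - 1))).restrictScalars ℝ)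
    (fun z _ => ((hasDerivAt_pow m z).hasFDerivAt.restrictScalars ℝ).hasFDerivWithinAt)
    (injOn_pow_sheet hρ m ζ)]
  simp only [abs_det_restrictScalars_smulRight, smul_eq_mul]

/-! ### Polynomial approximation of the indicator function of a sheet -/

/-- A holomorphic function is uniformly close to a polynomial on a smaller closed disk. -/
theorem exists_polynomial_near {f : ℂ → ℂ} {c : ℂ} {R s : ℝ} (hf : DifferentiableOn ℂ f
    (Metric.ball c R)) (hs : 0 ≤ s) (hsR : s < R) {η : ℝ} (hη : 0 < η) :
    ∃ p : ℂ[X], ∀ u ∈ Metric.closedBall c s, ‖f u - p.eval u‖ ≤ η := by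
  obtain ⟨s₁, hs1, hs1R⟩ := exists_between hsR
  obtain ⟨s₂, hs2, hs2R⟩ := exists_between hs1R
  lift s₁ to NNReal using hs.trans hs1.le
  lift s₂ to NNReal using s₁.2.trans hs2.le
  have hpos : 0 < s₂ := lt_of_le_of_lt s₁.2 (NNReal.coe_lt_coe.1 hs2)
  have h := (hf.mono (Metric.closedBall_subset_ball hs2R)).hasFPowerSeriesOnBall hpos
  have hu := h.tendstoUniformlyOn' (r' := s₁) (by exact_mod_cast hs2)
  rw [Metric.tendstoUniformlyOn_iff] at hu
  obtain ⟨n, hn⟩ := (hu η hη).exists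
  refine ⟨∑ k ∈ Finset.range n, C ((cauchyPowerSeries f c s₂).coeff k) * (X - C c) ^ k,
    fun u hus => ?_⟩
  have := (hn u (Metric.closedBall_subset_ball hs1 hus)).le
  rw [dist_eq_norm] at this
  have heq : (∑ k ∈ Finset.range n, C ((cauchyPowerSeries f c s₂).coeff k) * (X - C c) ^ k).eval u
      = (cauchyPowerSeries f c s₂).partialSum n (u - c) := by
    rw [eval_finsetSum]
    refine Finset.sum_congr rfl fun k _ => ?_
    rw [FormalMultilinearSeries.apply_eq_pow_smul_coeff]
    simp [mul_comm]
  rwa [heq]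

theorem norm_le_two {m : ℕ} (hm : m ≠ 0) {z : ℂ} (hz : ‖z ^ m - 1‖ ≤ 1) : ‖z‖ ≤ 2 := by
  by_contra! h
  have h1 : ‖z‖ ≤ ‖z‖ ^ m := le_self_pow₀ (by linarith) hm
  have h2 : ‖z ^ m‖ ≤ ‖z ^ m - 1‖ + ‖(1 : ℂ)‖ := by
    simpa using norm_add_le (z ^ m - 1) 1
  rw [norm_pow, norm_one] at h2
  linarith

/-- The Fourier expansion of the indicator function of `ζ` on the `m`-th roots of unity. -/
theorem sum_div_pow_eq {m : ℕ} (hm : m ≠ 0) {t ζ : ℂ} (ht : t ^ m = 1) (hζ : ζ ^ m = 1)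
    [Decidable (t = ζ)] :
    (m : ℂ)⁻¹ * ∑ l ∈ Finset.range m, (t / ζ) ^ l = if t = ζ then 1 else 0 := by
  have hm' : (m : ℂ) ≠ 0 := by exact_mod_cast hm
  have hζ0 : ζ ≠ 0 := by
    rintro rfl
    simp [zero_pow hm] at hζ
  split_ifs with h
  · subst h
    simp [div_self hζ0, hm']
  · have h1 : t / ζ ≠ 1 := fun h' => h ((div_eq_one_iff_eq hζ0).1 h')
    rw [geom_sum_eq h1, div_pow, ht, hζ]
    simp

open scoped Classical in
/-- The indicator function of a sheet is uniformly close to a polynomial divisible by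
`z ^ (m - 1)`, even on a slightly larger set. -/
theorem exists_polynomial_near_indicator {m : ℕ} (hm : m ≠ 0) {s : ℝ} (hs : 0 ≤ s) (hs1 : s < 1)
    {η : ℝ} (hη : 0 < η) {ζ : ℂ} (hζ : ζ ^ m = 1) :
    ∃ θ : ℂ[X], ∀ z : ℂ, ‖z ^ m - 1‖ ≤ s →
      ‖z ^ (m - 1) * θ.eval z - if branch m z = ζ then 1 else 0‖ ≤ η := by
  have hdiff : ∀ l : ℕ, DifferentiableOn ℂ (fun u : ℂ => ((u ^ ((m : ℂ)⁻¹)) ^ (l + m))⁻¹)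
      (Metric.ball 1 1) := by
    intro l u hu
    rw [Metric.mem_ball, dist_eq_norm] at hu
    have hslit : u ∈ Complex.slitPlane := by
      left
      have := (Complex.abs_re_le_norm (u - 1)).trans_lt hu
      rw [Complex.sub_re, Complex.one_re, abs_lt] at this
      linarith
    refine (DifferentiableAt.inv ?_ ?_).differentiableWithinAt
    · exact (differentiableAt_id.cpow (differentiableAt_const _) hslit).pow _
    · refine pow_ne_zero _ ?_
      rw [Complex.cpow_ne_zero_iff]
      exact Or.inl (ne_zero_of_norm_sub_one_lt hu)
  -- `z ^ (l + m)` times this function is `branch m z ^ l`; the shift by `m` in the exponent leaves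
  -- room for the factor `z ^ (m - 1)`.
  choose T hT using fun l => exists_polynomial_near (hdiff l) hs hs1
    (show 0 < η / 2 ^ (2 * m) by positivity)
  refine ⟨C (m : ℂ)⁻¹ * ∑ l ∈ Finset.range m, C (ζ ^ l)⁻¹ * X ^ (l + 1) * (T l).comp (X ^ m),
    fun z hz => ?_⟩
  have hz1 := hz.trans_lt hs1
  set q := (z ^ m) ^ ((m : ℂ)⁻¹) with hq
  have hq0 : q ≠ 0 := by
    rw [hq, Complex.cpow_ne_zero_iff]
    exact Or.inl (ne_zero_of_norm_sub_one_lt hz1)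
  have hzq : branch m z * q = z := branch_mul_root hz1
  have hb := branch_pow hm hz1
  have hm' : (0 : ℝ) < m := by exact_mod_cast Nat.pos_of_ne_zero hm
  have hζn : ‖ζ‖ = 1 := Complex.norm_eq_one_of_pow_eq_one hζ hm
  rw [← sum_div_pow_eq hm hb hζ]
  have hexp : z ^ (m - 1) * (C (m : ℂ)⁻¹ * ∑ l ∈ Finset.range m,
      C (ζ ^ l)⁻¹ * X ^ (l + 1) * (T l).comp (X ^ m)).eval z -
      (m : ℂ)⁻¹ * ∑ l ∈ Finset.range m, (branch m z / ζ) ^ l =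
      (m : ℂ)⁻¹ * ∑ l ∈ Finset.range m, -((ζ ^ l)⁻¹ * z ^ (l + m) *
        ((q ^ (l + m))⁻¹ - (T l).eval (z ^ m))) := by
    rw [eval_mul, eval_C, mul_left_comm, ← mul_sub, eval_finsetSum, Finset.mul_sum,
      ← Finset.sum_sub_distrib]
    congr 1
    refine Finset.sum_congr rfl fun l _ => ?_
    have h1 : (branch m z / ζ) ^ l = (ζ ^ l)⁻¹ * z ^ (l + m) * (q ^ (l + m))⁻¹ := by
      nth_rewrite 2 [← hzq]
      rw [mul_pow, pow_add _ l m, hb, div_pow]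
      field_simp
    have h2 : z ^ (l + m) = z ^ (m - 1) * z ^ (l + 1) := by
      rw [← pow_add]
      congr 1
      omega
    simp only [eval_mul, eval_C, eval_pow, eval_X, eval_comp]
    rw [h1, h2]
    ring
  rw [hexp, norm_mul, norm_inv, Complex.norm_natCast, inv_mul_le_iff₀ hm']
  calc _ ≤ ∑ l ∈ Finset.range m, η := by
        refine norm_sum_le_of_le _ fun l hl => ?_
        rw [norm_neg, norm_mul, norm_mul, norm_inv, norm_pow, hζn, one_pow, inv_one, one_mul,
          norm_pow]
        have h1 := hT l (z ^ m) (by rwa [Metric.mem_closedBall, dist_eq_norm])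
        have h2 : ‖z‖ ^ (l + m) ≤ 2 ^ (2 * m) :=
          (pow_le_pow_left₀ (norm_nonneg _) (norm_le_two hm hz1.le) _).trans
            (pow_le_pow_right₀ one_le_two (by have := Finset.mem_range.1 hl; omega))
        calc _ ≤ 2 ^ (2 * m) * (η / 2 ^ (2 * m)) := by gcongr
          _ = η := by field_simp
    _ = m * η := by simp

theorem sum_pow_mul_of_isPrimitiveRoot {m : ℕ} {ω : ℂ} (hω : IsPrimitiveRoot ω m)
    (j : ℕ) : ∑ i ∈ Finset.range m, (ω ^ i) ^ j = if m ∣ j then (m : ℂ) else 0 := by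
  simp only [← pow_mul, mul_comm _ j]
  simp only [pow_mul]
  split_ifs with h
  · simp [(hω.pow_eq_one_iff_dvd j).2 h]
  · have h1 : ω ^ j ≠ 1 := fun h' => h ((hω.pow_eq_one_iff_dvd j).1 h')
    rw [geom_sum_eq h1, ← pow_mul, mul_comm, pow_mul, hω.pow_eq_one]
    simp

/-- The sum of a polynomial over a rotation orbit is a polynomial in `z ^ m`. -/
theorem exists_eval_pow_eq_sum {m : ℕ} {ω : ℂ} (hω : IsPrimitiveRoot ω m)
    (Q : ℂ[X]) : ∃ f : ℂ[X], f.natDegree ≤ Q.natDegree / m ∧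
      ∀ z, f.eval (z ^ m) = ∑ i ∈ Finset.range m, Q.eval (ω ^ i * z) := by
  refine ⟨∑ j ∈ Finset.range (Q.natDegree + 1),
    C (Q.coeff j * if m ∣ j then (m : ℂ) else 0) * X ^ (j / m), ?_, fun z => ?_⟩
  · refine natDegree_sum_le_of_forall_le _ _ fun j hj => ?_
    refine (natDegree_C_mul_X_pow_le _ _).trans (Nat.div_le_div_right ?_)
    exact Nat.lt_succ_iff.1 (Finset.mem_range.1 hj)
  · rw [eval_finsetSum]
    simp only [eval_eq_sum_range (p := Q)]
    rw [Finset.sum_comm]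
    refine Finset.sum_congr rfl fun j _ => ?_
    simp only [eval_mul, eval_C, eval_pow, eval_X, mul_pow]
    rw [← Finset.mul_sum, ← Finset.sum_mul, sum_pow_mul_of_isPrimitiveRoot hω]
    split_ifs with h
    · rw [← pow_mul, Nat.mul_div_cancel' h, mul_assoc]
    · simp

/-! ### Area measure on the lemniscate region -/

theorem isOpen_region (r : ℝ) (m : ℕ) : IsOpen (region r m) :=
  isOpen_lt (by fun_prop) continuous_const

theorem region_subset_closedBall {r : ℝ} (hr0 : 0 < r) (hr1 : r < 1) {m : ℕ} (hm : m ≠ 0) :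
    region r m ⊆ Metric.closedBall 0 2 := by
  intro z hz
  rw [mem_closedBall_zero_iff]
  exact norm_le_two hm ((show ‖z ^ m - 1‖ < r ^ m from hz).le.trans (pow_le_one₀ hr0.le hr1.le))

theorem integrableOn_region {E : Type*} [NormedAddCommGroup E] {r : ℝ} (hr0 : 0 < r) (hr1 : r < 1)
    {m : ℕ} (hm : m ≠ 0) {f : ℂ → E} (hf : Continuous f) : IntegrableOn f (region r m) :=
  (hf.continuousOn.integrableOn_compact (isCompact_closedBall 0 2)).mono_set
    (region_subset_closedBall hr0 hr1 hm)

theorem isFiniteMeasure_areaMeasure {r : ℝ} (hr0 : 0 < r) (hr1 : r < 1) {m : ℕ} (hm : m ≠ 0) :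
    IsFiniteMeasure (areaMeasure r m) := by
  refine ⟨?_⟩
  rw [areaMeasure, Measure.restrict_apply_univ]
  exact (measure_mono (region_subset_closedBall hr0 hr1 hm)).trans_lt measure_closedBall_lt_top

theorem areaMeasure_compl_closedBall {r : ℝ} (hr0 : 0 < r) (hr1 : r < 1) {m : ℕ} (hm : m ≠ 0) :
    areaMeasure r m (Metric.closedBall 0 2)ᶜ = 0 := by
  rw [areaMeasure, Measure.restrict_apply Metric.isClosed_closedBall.measurableSet.compl]
  convert measure_empty (μ := volume)
  rw [← Set.disjoint_iff_inter_eq_empty, Set.disjoint_compl_left_iff_subset]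
  exact region_subset_closedBall hr0 hr1 hm

theorem areaMeasure_compl_finite_ne_zero {r : ℝ} (hr0 : 0 < r) (m : ℕ) (S : Set ℂ)
    (hS : S.Finite) : areaMeasure r m Sᶜ ≠ 0 := by
  rw [areaMeasure, Measure.restrict_apply hS.measurableSet.compl, Set.inter_comm,
    ← Set.sdiff_eq, measure_sdiff_null (hS.measure_zero _)]
  exact ((isOpen_region r m).measure_pos _ ⟨1, by simp [region]; positivity⟩).ne'

/-! ### The model kernel -/

/-- The reproducing kernel of the functions that on each sheet have the form
`z ^ (m - 1) * f (z ^ m)` with `f` a polynomial of degree less than `N`, at two points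
of the same sheet. -/
noncomputable def modelKernel (ρ : ℝ) (m N : ℕ) (z w : ℂ) : ℂ :=
  (m : ℂ) * z ^ (m - 1) * conj ((m : ℂ) * w ^ (m - 1)) * diskKernel ρ N (z ^ m) (w ^ m)

theorem modelKernel_self (ρ : ℝ) (m N : ℕ) (w : ℂ) :
    modelKernel ρ m N w w = ((‖(m : ℂ) * w ^ (m - 1)‖ ^ 2 *
      (diskKernel ρ N (w ^ m) (w ^ m)).re : ℝ) : ℂ) := by
  have h : diskKernel ρ N (w ^ m) (w ^ m) = ((diskKernel ρ N (w ^ m) (w ^ m)).re : ℂ) := by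
    rw [diskKernel_self, Complex.ofReal_re]
  rw [modelKernel, Complex.mul_conj, Complex.normSq_eq_norm_sq, Complex.ofReal_mul, ← h]

theorem modelKernel_self_re (ρ : ℝ) (m N : ℕ) (w : ℂ) :
    (modelKernel ρ m N w w).re = ‖(m : ℂ) * w ^ (m - 1)‖ ^ 2 *
      (diskKernel ρ N (w ^ m) (w ^ m)).re := by
  rw [modelKernel_self, Complex.ofReal_re]

/-! ### The upper bound on the diagonal -/

section Upper

variable {m : ℕ} {ω : ℂ}

open scoped Classical in
/-- If `z ^ (m - 1) * θ` is close to the indicator function of a sheet, then on that sheet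
the polynomial `P` is close to `z ^ (m - 1)` times the rotation average of `P * θ`. -/
theorem norm_mul_sum_sub_le (hω : IsPrimitiveRoot ω m) (hm : m ≠ 0) {s η : ℝ}
    {ζ : ℂ} {θ : ℂ[X]} (hθ : ∀ z : ℂ, ‖z ^ m - 1‖ ≤ s →
      ‖z ^ (m - 1) * θ.eval z - if branch m z = ζ then 1 else 0‖ ≤ η) (hζ : ζ ^ m = 1)
    (P : ℂ[X]) {z : ℂ} (hz : ‖z ^ m - 1‖ ≤ s) (hzζ : branch m z = ζ) :
    ‖z ^ (m - 1) * (∑ i ∈ Finset.range m, (P * θ).eval (ω ^ i * z)) - P.eval z‖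
      ≤ η * ∑ i ∈ Finset.range m, ‖P.eval (ω ^ i * z)‖ := by
  have hωi : ∀ i : ℕ, (ω ^ i) ^ m = 1 := fun i => by
    rw [← pow_mul, mul_comm, pow_mul, hω.pow_eq_one, one_pow]
  have hζ0 : ζ ≠ 0 := by
    rintro rfl
    simp [zero_pow hm] at hζ
  have hP : P.eval z = ∑ i ∈ Finset.range m,
      ω ^ i * P.eval (ω ^ i * z) * if i = 0 then 1 else 0 := by
    simp [Nat.pos_of_ne_zero hm]
  rw [hP, Finset.mul_sum, ← Finset.sum_sub_distrib, Finset.mul_sum]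
  refine norm_sum_le_of_le _ fun i hi => ?_
  have h1 : ‖(ω ^ i * z) ^ m - 1‖ ≤ s := by rwa [mul_pow, hωi, one_mul]
  have h2 : branch m (ω ^ i * z) = ζ ↔ i = 0 := by
    rw [branch_mul (hωi i), hzζ]
    constructor
    · intro h
      have : ω ^ i = 1 := mul_right_cancel₀ hζ0 (h.trans (one_mul ζ).symm)
      by_contra hi0
      exact hω.pow_ne_one_of_pos_of_lt hi0 (Finset.mem_range.1 hi) this
    · rintro rfl
      simp
  have h3 : z ^ (m - 1) = ω ^ i * (ω ^ i * z) ^ (m - 1) := by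
    have : ω ^ i * (ω ^ i) ^ (m - 1) = 1 := by
      rw [← pow_succ', Nat.sub_add_cancel (Nat.pos_of_ne_zero hm), hωi]
    rw [mul_pow, ← mul_assoc, this, one_mul]
  have h4 := hθ _ h1
  simp only [h2] at h4
  have h5 : z ^ (m - 1) * (P * θ).eval (ω ^ i * z) - ω ^ i * P.eval (ω ^ i * z) *
      (if i = 0 then 1 else 0) = ω ^ i * P.eval (ω ^ i * z) *
        ((ω ^ i * z) ^ (m - 1) * θ.eval (ω ^ i * z) - if i = 0 then 1 else 0) := by
    rw [h3, eval_mul]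
    ring
  rw [h5, norm_mul, norm_mul, Complex.norm_eq_one_of_pow_eq_one (hωi i) hm, one_mul, mul_comm]
  gcongr

variable {r : ℝ}

theorem setIntegral_region_rotate (hω : IsPrimitiveRoot ω m) (hm : m ≠ 0) (i : ℕ) (f : ℂ → ℝ) :
    ∫ z in region r m, f (ω ^ i * z) = ∫ z in region r m, f z := by
  have hωi : (ω ^ i) ^ m = 1 := by
    rw [← pow_mul, mul_comm, pow_mul, hω.pow_eq_one, one_pow]
  refine setIntegral_comp_unit_mul (Complex.norm_eq_one_of_pow_eq_one hωi hm) (fun z => ?_) f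
  simp only [region, Set.mem_ofPred_eq, mul_pow, hωi, one_mul]

open scoped Classical in
/-- The rotation average `f (z ^ m)` of `P * θ` has on the disk a squared norm at most slightly
larger than `m ^ 2` times that of `P` on the whole region. -/
theorem integral_ball_average_le (hr0 : 0 < r) (hr1 : r < 1)
    (hω : IsPrimitiveRoot ω m) (hm : m ≠ 0) {η : ℝ} (hη : 0 ≤ η)
    {ζ : ℂ} {θ : ℂ[X]} (hθ : ∀ z : ℂ, ‖z ^ m - 1‖ ≤ r ^ m →
      ‖z ^ (m - 1) * θ.eval z - if branch m z = ζ then 1 else 0‖ ≤ η) (hζ : ζ ^ m = 1)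
    (P f : ℂ[X]) (hf : ∀ z, f.eval (z ^ m) = ∑ i ∈ Finset.range m, (P * θ).eval (ω ^ i * z)) :
    ∫ u in Metric.ball (1 : ℂ) (r ^ m), ‖f.eval u‖ ^ 2
      ≤ m ^ 2 * ((1 + η + (η + η ^ 2) * m ^ 2) * ∫ z, ‖P.eval z‖ ^ 2 ∂(areaMeasure r m)) := by
  have hρ : r ^ m ≤ 1 := pow_le_one₀ hr0.le hr1.le
  have hsub : sheet (r ^ m) m ζ ⊆ region r m := fun z hz => hz.1
  rw [← integral_sheet hρ hm hζ]
  have hpt : ∀ z ∈ sheet (r ^ m) m ζ, ‖(m : ℂ) * z ^ (m - 1)‖ ^ 2 * ‖f.eval (z ^ m)‖ ^ 2 ≤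
      m ^ 2 * ((1 + η) * ‖P.eval z‖ ^ 2 +
        (η + η ^ 2) * (m * ∑ i ∈ Finset.range m, ‖P.eval (ω ^ i * z)‖ ^ 2)) := by
    intro z hz
    have h1 := norm_mul_sum_sub_le hω hm hθ hζ P hz.1.le hz.2
    rw [← hf] at h1
    set x := ‖P.eval z‖
    set y := ∑ i ∈ Finset.range m, ‖P.eval (ω ^ i * z)‖
    have h2 : ‖z ^ (m - 1) * f.eval (z ^ m)‖ ≤ x + η * y := by
      have := norm_add_le (z ^ (m - 1) * f.eval (z ^ m) - P.eval z) (P.eval z)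
      rw [sub_add_cancel] at this
      linarith
    have h3 : y ^ 2 ≤ m * ∑ i ∈ Finset.range m, ‖P.eval (ω ^ i * z)‖ ^ 2 := by
      simpa using sq_sum_le_card_mul_sum_sq (s := Finset.range m)
        (f := fun i => ‖P.eval (ω ^ i * z)‖)
    -- Weighted so that the coefficient of `x ^ 2` tends to `1` as `η → 0`.
    have h4 : (x + η * y) ^ 2 ≤ (1 + η) * x ^ 2 + (η + η ^ 2) * y ^ 2 := by
      nlinarith [mul_nonneg hη (sq_nonneg (x - y))]
    have h5 : ‖(m : ℂ) * z ^ (m - 1)‖ ^ 2 * ‖f.eval (z ^ m)‖ ^ 2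
        = m ^ 2 * ‖z ^ (m - 1) * f.eval (z ^ m)‖ ^ 2 := by
      rw [norm_mul, norm_mul, Complex.norm_natCast]
      ring
    rw [h5]
    gcongr
    calc _ ≤ (x + η * y) ^ 2 := by gcongr
      _ ≤ _ := h4
      _ ≤ _ := by gcongr
  have hI : ∀ i : ℕ, IntegrableOn (fun z => ‖P.eval (ω ^ i * z)‖ ^ 2) (region r m) := fun i =>
    integrableOn_region hr0 hr1 hm (by fun_prop)
  have hcont : Continuous fun z : ℂ => m ^ 2 * ((1 + η) * ‖P.eval z‖ ^ 2 +
        (η + η ^ 2) * (m * ∑ i ∈ Finset.range m, ‖P.eval (ω ^ i * z)‖ ^ 2)) := by fun_prop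
  calc _ ≤ ∫ z in sheet (r ^ m) m ζ, (m ^ 2 * ((1 + η) * ‖P.eval z‖ ^ 2 +
        (η + η ^ 2) * (m * ∑ i ∈ Finset.range m, ‖P.eval (ω ^ i * z)‖ ^ 2)) : ℝ) := by
        refine setIntegral_mono_on ?_ ?_ (measurableSet_sheet _ _ _) hpt
        · exact (integrableOn_region hr0 hr1 hm (by fun_prop)).mono_set hsub
        · exact (integrableOn_region hr0 hr1 hm hcont).mono_set hsub
    _ ≤ ∫ z in region r m, (m ^ 2 * ((1 + η) * ‖P.eval z‖ ^ 2 +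
        (η + η ^ 2) * (m * ∑ i ∈ Finset.range m, ‖P.eval (ω ^ i * z)‖ ^ 2)) : ℝ) := by
        refine setIntegral_mono_set (integrableOn_region hr0 hr1 hm hcont)
          (Filter.Eventually.of_forall fun z => ?_) (Filter.Eventually.of_forall hsub)
        simp only [Pi.zero_apply]
        positivity
    _ = _ := by
        have hP : IntegrableOn (fun z => ‖P.eval z‖ ^ 2) (region r m) :=
          integrableOn_region hr0 hr1 hm (by fun_prop)
        rw [integral_const_mul, integral_add (hP.const_mul _)
          (((integrable_finsetSum _ fun i _ => hI i).const_mul _).const_mul _), integral_const_mul,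
          integral_const_mul, integral_const_mul, integral_finsetSum _ fun i _ => hI i]
        simp only [setIntegral_region_rotate hω hm _ fun z => ‖P.eval z‖ ^ 2]
        rw [areaMeasure]
        simp only [Finset.sum_const, Finset.card_range, nsmul_eq_mul]
        ring

theorem modelKernel_self_rotate {ζ : ℂ} (hm : m ≠ 0) (hζ : ζ ^ m = 1) (ρ : ℝ) (N : ℕ)
    (w : ℂ) : (modelKernel ρ m N (ζ * w) (ζ * w)).re = (modelKernel ρ m N w w).re := by
  simp only [modelKernel_self_re, mul_pow, hζ, one_mul, norm_mul, norm_pow,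
    Complex.norm_eq_one_of_pow_eq_one hζ hm, one_pow]

open scoped Classical in
/-- Upper bound for the diagonal of the reproducing kernel. At a point of a rotation orbit where
`K_n(w, w)` is largest, the values of `K_n(·, w)` at the other points of the orbit are controlled
by `K_n(w, w)`. -/
theorem kernel_self_le (hr0 : 0 < r) (hr1 : r < 1) (hm : m ≠ 0) {s η : ℝ} (hη : 0 ≤ η)
    (hmη : m * η ≤ 1) (hrs : r ^ m ≤ s) (hs : s < 1) {d : ℕ} {θ : ℂ → ℂ[X]}
    (hd : ∀ ζ, ζ ^ m = 1 → (θ ζ).natDegree ≤ d)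
    (hθ : ∀ ζ, ζ ^ m = 1 → ∀ z : ℂ, ‖z ^ m - 1‖ ≤ s →
      ‖z ^ (m - 1) * (θ ζ).eval z - if branch m z = ζ then 1 else 0‖ ≤ η)
    (n : ℕ) {w : ℂ} (hw : ‖w ^ m - 1‖ ≤ s) :
    (OrthPoly.kernel (areaMeasure r m) n w w).re * (1 - m * η) ^ 2 ≤
      (1 + η + (η + η ^ 2) * m ^ 2) * (modelKernel (r ^ m) m ((n + d) / m + 1) w w).re := by
  have := isFiniteMeasure_areaMeasure hr0 hr1 hm
  have hω := Complex.isPrimitiveRoot_exp m hm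
  set ω := Complex.exp (2 * Real.pi * Complex.I / m)
  have hωi : ∀ i : ℕ, (ω ^ i) ^ m = 1 := fun i => by
    rw [← pow_mul, mul_comm, pow_mul, hω.pow_eq_one, one_pow]
  have hK := isCompact_closedBall (0 : ℂ) 2
  have hμK := areaMeasure_compl_closedBall hr0 hr1 hm
  have hinf := areaMeasure_compl_finite_ne_zero hr0 m
  set μ := areaMeasure r m with hμ
  -- The point of the orbit of `w` at which the kernel is largest on the diagonal.
  obtain ⟨i₀, -, hi₀⟩ := Finset.exists_max_image (Finset.range m)
    (fun i => (OrthPoly.kernel μ n (ω ^ i * w) (ω ^ i * w)).re) ⟨0, by simp; omega⟩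
  rw [← modelKernel_self_rotate hm (hωi i₀)]
  set w' := ω ^ i₀ * w with hw'_def
  have hw' : ‖w' ^ m - 1‖ ≤ s := by rwa [hw'_def, mul_pow, hωi, one_mul]
  set M := (OrthPoly.kernel μ n w' w').re
  have hM : 0 ≤ M := OrthPoly.kernel_self_re_nonneg _ _ _
  have hmax : ∀ i : ℕ, (OrthPoly.kernel μ n (ω ^ i * w') (ω ^ i * w')).re ≤ M := by
    intro i
    have h := hi₀ ((i + i₀) % m) (Finset.mem_range.2 (Nat.mod_lt _ (Nat.pos_of_ne_zero hm)))
    have h1 : ω ^ ((i + i₀) % m) = ω ^ i * ω ^ i₀ := by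
      rw [← pow_add]
      exact (pow_eq_pow_mod _ hω.pow_eq_one).symm
    rwa [h1, mul_assoc] at h
  have hwM : (OrthPoly.kernel μ n w w).re ≤ M := by
    have h := hi₀ 0 (by simp; omega)
    simpa using h
  have hζ := branch_pow hm (hw'.trans_lt hs)
  set ζ := branch m w' with hζ_def
  set P := OrthPoly.kernelPoly μ n w'
  have hPdeg : P.natDegree ≤ n := OrthPoly.natDegree_kernelPoly_le μ n w'
  have hPnorm : ∫ z, ‖P.eval z‖ ^ 2 ∂μ = M :=
    OrthPoly.integral_norm_sq_kernelPoly hK hμK hinf n w'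
  have hPw : ‖P.eval w'‖ = M := by
    rw [OrthPoly.eval_kernelPoly, OrthPoly.kernel_self_eq, Complex.norm_real,
      Real.norm_of_nonneg (by positivity), ← OrthPoly.kernel_self_re]
  have hPi : ∀ i : ℕ, ‖P.eval (ω ^ i * w')‖ ≤ M := by
    intro i
    have h := OrthPoly.norm_sq_eval_le hK hμK hinf hPdeg (ω ^ i * w')
    rw [hPnorm] at h
    refine le_of_sq_le_sq (h.trans ?_) hM
    rw [sq]
    exact mul_le_mul_of_nonneg_right (hmax i) hM
  obtain ⟨f, hfdeg, hf⟩ := exists_eval_pow_eq_sum hω (P * θ ζ)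
  have hfN : f.natDegree < (n + d) / m + 1 := by
    refine Nat.lt_succ_of_le (hfdeg.trans (Nat.div_le_div_right ?_))
    exact natDegree_mul_le.trans (add_le_add hPdeg (hd ζ hζ))
  have hint := integral_ball_average_le hr0 hr1 hω hm hη
    (fun z hz => hθ ζ hζ z (hz.trans hrs)) hζ P f hf
  rw [← hμ, hPnorm] at hint
  have hev := norm_sq_eval_le_diskKernel (pow_pos hr0 m) hfN (w' ^ m)
  have hdist := norm_mul_sum_sub_le hω hm (hθ ζ hζ) hζ P hw' rfl
  rw [← hf] at hdist
  have hsum : ∑ i ∈ Finset.range m, ‖P.eval (ω ^ i * w')‖ ≤ m * M := by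
    simpa using Finset.sum_le_card_nsmul (Finset.range m) _ M fun i _ => hPi i
  have hlow : M * (1 - m * η) ≤ ‖w' ^ (m - 1) * f.eval (w' ^ m)‖ := by
    have h1 := norm_sub_le (w' ^ (m - 1) * f.eval (w' ^ m))
      (w' ^ (m - 1) * f.eval (w' ^ m) - P.eval w')
    rw [sub_sub_cancel, hPw] at h1
    have h2 := mul_le_mul_of_nonneg_left hsum hη
    linarith
  have hD := diskKernel_self_re_nonneg (r ^ m) ((n + d) / m + 1) (w' ^ m)
  have hsq : (M * (1 - m * η)) ^ 2 ≤ ((1 + η + (η + η ^ 2) * m ^ 2) *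
      (modelKernel (r ^ m) m ((n + d) / m + 1) w' w').re) * M := by
    calc _ ≤ ‖w' ^ (m - 1) * f.eval (w' ^ m)‖ ^ 2 :=
          pow_le_pow_left₀ (mul_nonneg hM (by linarith)) hlow 2
      _ = ‖w' ^ (m - 1)‖ ^ 2 * ‖f.eval (w' ^ m)‖ ^ 2 := by rw [norm_mul, mul_pow]
      _ ≤ ‖w' ^ (m - 1)‖ ^ 2 * ((diskKernel (r ^ m) ((n + d) / m + 1) (w' ^ m) (w' ^ m)).re *
          (m ^ 2 * ((1 + η + (η + η ^ 2) * m ^ 2) * M))) := by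
        gcongr
        exact hev.trans (by gcongr)
      _ = _ := by
        rw [modelKernel_self_re, norm_mul, Complex.norm_natCast]
        ring
  have hR : 0 ≤ (modelKernel (r ^ m) m ((n + d) / m + 1) w' w').re := by
    rw [modelKernel_self_re]
    positivity
  refine (mul_le_mul_of_nonneg_right hwM (sq_nonneg _)).trans ?_
  rcases hM.eq_or_lt with h0 | hpos
  · rw [← h0, zero_mul]
    positivity
  · refine le_of_mul_le_mul_right ?_ hpos
    calc _ = (M * (1 - m * η)) ^ 2 := by ring
      _ ≤ _ := hsq

end Upper

/-! ### The comparison polynomial -/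

section Lower

variable {m : ℕ} {r : ℝ}

theorem exists_eval_eq_diskKernel (ρ : ℝ) (N : ℕ) (v : ℂ) :
    ∃ p : ℂ[X], p.natDegree ≤ N - 1 ∧ ∀ u, p.eval u = diskKernel ρ N u v := by
  refine ⟨∑ k ∈ Finset.range N, C (((k + 1) / (Real.pi * ρ ^ 2) : ℂ)) *
    (C (conj ((v - 1) / ρ) / ρ) * (X - C 1)) ^ k, ?_, fun u => ?_⟩
  · refine natDegree_sum_le_of_forall_le _ _ fun k hk => ?_
    refine (natDegree_C_mul_le _ _).trans (natDegree_pow_le.trans ?_)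
    have h1 : (C (conj ((v - 1) / ρ) / ρ) * (X - C 1)).natDegree ≤ 1 :=
      (natDegree_C_mul_le _ _).trans (natDegree_X_sub_C_le 1)
    have := Finset.mem_range.1 hk
    calc k * _ ≤ k * 1 := Nat.mul_le_mul_left k h1
      _ ≤ N - 1 := by omega
  · rw [eval_finsetSum, diskKernel]
    refine Finset.sum_congr rfl fun k _ => ?_
    simp only [eval_mul, eval_C, eval_pow, eval_sub, eval_X]
    congr 2
    ring

theorem region_eq_biUnion_sheet (hr0 : 0 < r) (hr1 : r < 1) (hm : m ≠ 0) :
    region r m = ⋃ ζ ∈ nthRootsFinset m (1 : ℂ), sheet (r ^ m) m ζ := by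
  ext z
  simp only [Set.mem_iUnion, exists_prop, mem_nthRootsFinset (Nat.pos_of_ne_zero hm)]
  constructor
  · intro hz
    exact ⟨branch m z, branch_pow hm (lt_of_lt_of_le hz (pow_le_one₀ hr0.le hr1.le)), hz, rfl⟩
  · rintro ⟨ζ, -, hz⟩
    exact hz.1

open scoped Classical in
/-- A polynomial that on the sheet labelled by `ζ` imitates the model kernel and is small on the
other sheets. -/
theorem exists_polynomial_near_modelKernel (hr0 : 0 < r) (hr1 : r < 1) (hm : m ≠ 0) {η : ℝ}
    (hη : 0 ≤ η) {ζ : ℂ} (hζ : ζ ^ m = 1) {θ : ℂ[X]} (hθ : ∀ z : ℂ, ‖z ^ m - 1‖ ≤ r ^ m →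
      ‖z ^ (m - 1) * θ.eval z - if branch m z = ζ then 1 else 0‖ ≤ η) (N : ℕ) (w : ℂ) :
    ∃ P : ℂ[X], P.natDegree ≤ θ.natDegree + 2 * (m - 1) + m * (N - 1) ∧
      (∀ z, P.eval z = z ^ (m - 1) * θ.eval z * modelKernel (r ^ m) m N z w) ∧
      ∫ z, ‖P.eval z‖ ^ 2 ∂(areaMeasure r m)
        ≤ (1 + 2 * η + m * η ^ 2) * (modelKernel (r ^ m) m N w w).re := by
  have hρ : r ^ m ≤ 1 := pow_le_one₀ hr0.le hr1.le
  obtain ⟨p, hpdeg, hp⟩ := exists_eval_eq_diskKernel (r ^ m) N (w ^ m)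
  have heval : ∀ z, (X ^ (m - 1) * θ * (C ((m : ℂ) * conj ((m : ℂ) * w ^ (m - 1))) *
      X ^ (m - 1) * p.comp (X ^ m))).eval z
      = z ^ (m - 1) * θ.eval z * modelKernel (r ^ m) m N z w := by
    intro z
    simp only [eval_mul, eval_pow, eval_X, eval_C, eval_comp, hp, modelKernel]
    ring
  refine ⟨_, ?_, heval, ?_⟩
  · have h1 : (X ^ (m - 1) * θ).natDegree ≤ (m - 1) + θ.natDegree :=
      natDegree_mul_le.trans (by rw [natDegree_X_pow])
    have h2 : (C ((m : ℂ) * conj ((m : ℂ) * w ^ (m - 1))) * X ^ (m - 1)).natDegree ≤ m - 1 :=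
      natDegree_C_mul_X_pow_le _ _
    have h3 : (p.comp (X ^ m : ℂ[X])).natDegree ≤ m * (N - 1) := by
      rw [natDegree_comp, natDegree_X_pow, mul_comm]
      exact Nat.mul_le_mul_left m hpdeg
    refine natDegree_mul_le.trans ((add_le_add h1 (natDegree_mul_le.trans
      (add_le_add h2 h3))).trans ?_)
    omega
  simp only [heval]
  set B := ‖(m : ℂ) * w ^ (m - 1)‖ ^ 2
  set F : ℂ → ℝ := fun u => ‖diskKernel (r ^ m) N u (w ^ m)‖ ^ 2
  have hFcont : Continuous F := by
    simp only [F, diskKernel]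
    fun_prop
  have hmodel : ∀ z, ‖modelKernel (r ^ m) m N z w‖ ^ 2
      = B * (‖(m : ℂ) * z ^ (m - 1)‖ ^ 2 * F (z ^ m)) := by
    intro z
    simp only [modelKernel, F, B, norm_mul, RCLike.norm_conj]
    ring
  have hint : ∀ ξ : ℂ, ξ ^ m = 1 → ∫ z in sheet (r ^ m) m ξ,
      ‖z ^ (m - 1) * θ.eval z * modelKernel (r ^ m) m N z w‖ ^ 2
        ≤ ((if ξ = ζ then 1 + 2 * η else 0) + η ^ 2) * (modelKernel (r ^ m) m N w w).re := by
    intro ξ hξ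
    have hsub : sheet (r ^ m) m ξ ⊆ region r m := fun z hz => hz.1
    have hmc : Continuous fun z => modelKernel (r ^ m) m N z w := by
      simp only [modelKernel, diskKernel]
      fun_prop
    calc _ ≤ ∫ z in sheet (r ^ m) m ξ, (((if ξ = ζ then 1 + 2 * η else 0) + η ^ 2) * B) *
          (‖(m : ℂ) * z ^ (m - 1)‖ ^ 2 * F (z ^ m)) := by
          refine setIntegral_mono_on ?_ ?_ (measurableSet_sheet _ _ _) fun z hz => ?_
          · exact (integrableOn_region hr0 hr1 hm (by fun_prop)).mono_set hsub
          · exact (integrableOn_region hr0 hr1 hm (by fun_prop)).mono_set hsub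
          · rw [norm_mul, mul_pow, hmodel, ← mul_assoc]
            have h1 := hθ z hz.1.le
            rw [hz.2] at h1
            have h2 : ‖z ^ (m - 1) * θ.eval z‖ ^ 2
                ≤ (if ξ = ζ then 1 + 2 * η else 0) + η ^ 2 := by
              split_ifs at h1 ⊢
              · have h3 := norm_add_le (z ^ (m - 1) * θ.eval z - 1) 1
                rw [sub_add_cancel, norm_one] at h3
                nlinarith [norm_nonneg (z ^ (m - 1) * θ.eval z)]
              · rw [sub_zero] at h1
                nlinarith [norm_nonneg (z ^ (m - 1) * θ.eval z)]
            have : 0 ≤ F (z ^ m) := sq_nonneg _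
            gcongr
      _ = _ := by
          rw [integral_const_mul, integral_sheet hρ hm hξ,
            integral_ball_norm_sq_diskKernel (pow_pos hr0 m), modelKernel_self_re]
          ring
  rw [areaMeasure, region_eq_biUnion_sheet hr0 hr1 hm,
    integral_biUnion_finset _ fun ξ _ => measurableSet_sheet _ _ _]
  · refine (Finset.sum_le_sum fun ξ hξ => hint ξ
      ((mem_nthRootsFinset (Nat.pos_of_ne_zero hm) _).1 hξ)).trans ?_
    rw [← Finset.sum_mul, Finset.sum_add_distrib, Finset.sum_ite_eq',
      if_pos ((mem_nthRootsFinset (Nat.pos_of_ne_zero hm) _).2 hζ), Finset.sum_const,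
      (Complex.isPrimitiveRoot_exp m hm).card_nthRootsFinset, nsmul_eq_mul]
  · intro ξ _ ξ' _ hne
    refine Set.disjoint_left.2 fun z hz hz' => hne (hz.2.symm.trans hz'.2)
  · intro ξ _
    have hsub : sheet (r ^ m) m ξ ⊆ region r m := fun z hz => hz.1
    have hmc : Continuous fun z => modelKernel (r ^ m) m N z w := by
      simp only [modelKernel, diskKernel]
      fun_prop
    exact (integrableOn_region hr0 hr1 hm (by fun_prop)).mono_set hsub

end Lower

/-! ### Riemann sums for `H` -/

theorem integral_mul_exp_eq (A : ℂ) :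
    ∫ t in (0 : ℝ)..1, (t : ℂ) * Complex.exp (A * t) = H A / 2 := by
  rw [H]
  split_ifs with hA
  · subst hA
    have : ∫ t in (0 : ℝ)..1, (t : ℂ) = ((∫ t in (0 : ℝ)..1, t : ℝ) : ℂ) :=
      intervalIntegral.integral_ofReal
    simp [this]
  · have hderiv : ∀ t ∈ Set.uIcc (0 : ℝ) 1, HasDerivAt
        (fun t : ℝ => ((t : ℂ) / A - 1 / A ^ 2) * Complex.exp (A * t))
        ((t : ℂ) * Complex.exp (A * t)) t := by
      intro t _
      have h1 : HasDerivAt (fun t : ℝ => (t : ℂ) / A - 1 / A ^ 2) (1 / A) t :=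
        ((Complex.ofRealCLM.hasDerivAt (x := t)).div_const A).sub_const _
      have h2 : HasDerivAt (fun t : ℝ => Complex.exp (A * t)) (Complex.exp (A * t) * (A * 1)) t :=
        ((Complex.ofRealCLM.hasDerivAt (x := t)).const_mul A).cexp
      refine (h1.mul h2).congr_deriv ?_
      field_simp
      ring
    rw [intervalIntegral.integral_eq_sub_of_hasDerivAt hderiv
      (Continuous.intervalIntegrable (by fun_prop) _ _)]
    simp
    field_simp

theorem norm_H_le {M : ℝ} {A : ℂ} (hA : ‖A‖ ≤ M) : ‖H A‖ ≤ 2 * Real.exp M := by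
  have h : ‖∫ t in (0 : ℝ)..1, (t : ℂ) * Complex.exp (A * t)‖ ≤ Real.exp M * |1 - 0| := by
    refine intervalIntegral.norm_integral_le_of_norm_le_const fun t ht => ?_
    rw [Set.uIoc_of_le zero_le_one] at ht
    rw [norm_mul, Complex.norm_real, Real.norm_of_nonneg ht.1.le]
    have h1 : ‖Complex.exp (A * t)‖ ≤ Real.exp M := by
      refine (Complex.norm_exp_le_exp_norm _).trans (Real.exp_le_exp.2 ?_)
      rw [norm_mul, Complex.norm_real, Real.norm_of_nonneg ht.1.le]
      exact (mul_le_of_le_one_right (norm_nonneg _) ht.2).trans hA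
    calc _ ≤ 1 * Real.exp M := by gcongr; exact ht.2
      _ = _ := one_mul _
  rw [integral_mul_exp_eq, norm_div] at h
  simp at h
  linarith

theorem norm_exp_sub_exp_le {M : ℝ} {x y : ℂ} (hx : ‖x‖ ≤ M) (hy : ‖y‖ ≤ M) :
    ‖Complex.exp x - Complex.exp y‖ ≤ Real.exp M * ‖x - y‖ := by
  refine (convex_closedBall (0 : ℂ) M).norm_image_sub_le_of_norm_deriv_le
    (fun z _ => Complex.differentiable_exp z) (fun z hz => ?_)
    (mem_closedBall_zero_iff.2 hy) (mem_closedBall_zero_iff.2 hx)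
  rw [Complex.deriv_exp]
  exact (Complex.norm_exp_le_exp_norm _).trans (Real.exp_le_exp.2 (mem_closedBall_zero_iff.1 hz))

/-- A Riemann sum for `∫ t in 0..1, t * exp (A * t)`. -/
theorem norm_sum_exp_sub_le {M : ℝ} {A : ℂ} (hA : ‖A‖ ≤ M) {L : ℕ} (hL : 0 < L) :
    ‖∑ k ∈ Finset.range L, ((k : ℂ) + 1) * Complex.exp (A / L) ^ k - (L : ℂ) ^ 2 * (H A / 2)‖
      ≤ (1 + M) * Real.exp M * L := by
  have hL' : (0 : ℝ) < L := by exact_mod_cast hL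
  have hLc : (L : ℂ) ≠ 0 := by exact_mod_cast hL.ne'
  have hM : 0 ≤ M := (norm_nonneg _).trans hA
  set g : ℝ → ℂ := fun t => (t : ℂ) * Complex.exp (A * t) with hg
  have hgc : Continuous g := by fun_prop
  have hsum : ∑ k ∈ Finset.range L, ∫ t in ((k : ℝ) / L)..((k + 1 : ℕ) : ℝ) / L, g t = H A / 2 := by
    rw [intervalIntegral.sum_integral_adjacent_intervals (a := fun k : ℕ => (k : ℝ) / L)
      fun k _ => hgc.intervalIntegrable _ _]
    rw [← integral_mul_exp_eq]
    simp [hL'.ne', g]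
  have hlen : ∀ k : ℕ, ((k + 1 : ℕ) : ℝ) / L - (k : ℝ) / L = 1 / L := fun k => by
    push_cast
    ring
  have hterm : ∀ k ∈ Finset.range L, ‖((k : ℂ) + 1) * Complex.exp (A / L) ^ k -
      (L : ℂ) ^ 2 * ∫ t in ((k : ℝ) / L)..((k + 1 : ℕ) : ℝ) / L, g t‖
        ≤ (1 + M) * Real.exp M := by
    intro k hk
    have hkL : (k : ℝ) + 1 ≤ L := by exact_mod_cast Finset.mem_range.1 hk
    set c : ℂ := ((k : ℂ) + 1) / L * Complex.exp (A * (k / L : ℝ)) with hc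
    have hexp : Complex.exp (A / L) ^ k = Complex.exp (A * (k / L : ℝ)) := by
      rw [← Complex.exp_nat_mul]
      congr 1
      push_cast
      ring
    have h1 : ((k : ℂ) + 1) * Complex.exp (A / L) ^ k
        = (L : ℂ) ^ 2 * ∫ t in ((k : ℝ) / L)..((k + 1 : ℕ) : ℝ) / L, c := by
      rw [intervalIntegral.integral_const, hlen, hexp, hc, Complex.real_smul]
      push_cast
      field_simp
    rw [h1, ← mul_sub, ← intervalIntegral.integral_sub (by simp)
      (hgc.intervalIntegrable _ _), norm_mul]
    have h2 : ‖∫ t in ((k : ℝ) / L)..((k + 1 : ℕ) : ℝ) / L, (c - g t)‖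
        ≤ (1 + M) * Real.exp M / L * |((k + 1 : ℕ) : ℝ) / L - (k : ℝ) / L| := by
      refine intervalIntegral.norm_integral_le_of_norm_le_const fun t ht => ?_
      rw [Set.uIoc_of_le (by rw [← sub_nonneg, hlen]; positivity)] at ht
      obtain ⟨ht1, ht2⟩ := ht
      push_cast at ht2
      have hk0 : (0 : ℝ) ≤ (k : ℝ) / L := by positivity
      have ht0 : 0 ≤ t := hk0.trans ht1.le
      have ht3 : t ≤ 1 := ht2.trans ((div_le_one hL').2 hkL)
      have hsmall : t - k / L ≤ 1 / L := by
        have : ((k : ℝ) + 1) / L = k / L + 1 / L := add_div _ _ _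
        linarith
      have hbd : ∀ x : ℝ, 0 ≤ x → x ≤ 1 → ‖A * x‖ ≤ M := by
        intro x h0 h1
        rw [norm_mul, Complex.norm_real, Real.norm_of_nonneg h0]
        exact (mul_le_of_le_one_right (norm_nonneg _) h1).trans hA
      have e1 := norm_exp_sub_exp_le (hbd _ hk0 (ht1.le.trans ht3)) (hbd t ht0 ht3)
      have e2 : ‖A * ((k / L : ℝ) : ℂ) - A * t‖ ≤ M * (1 / L) := by
        rw [← mul_sub, norm_mul, ← Complex.ofReal_sub, Complex.norm_real, Real.norm_eq_abs,
          abs_of_nonpos (by linarith)]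
        exact mul_le_mul hA (by linarith) (by linarith) hM
      have e3 : ‖Complex.exp (A * ((k / L : ℝ) : ℂ))‖ ≤ Real.exp M :=
        (Complex.norm_exp_le_exp_norm _).trans (Real.exp_le_exp.2 (hbd _ hk0 (ht1.le.trans ht3)))
      have e4 : ‖((k : ℂ) + 1) / L - t‖ ≤ 1 / L := by
        have : ((k : ℂ) + 1) / L - t = (((k + 1) / L - t : ℝ) : ℂ) := by push_cast; rfl
        rw [this, Complex.norm_real, Real.norm_of_nonneg (by linarith)]
        have : ((k : ℝ) + 1) / L = k / L + 1 / L := add_div _ _ _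
        linarith
      have e5 : c - g t = (((k : ℂ) + 1) / L - t) * Complex.exp (A * ((k / L : ℝ) : ℂ)) +
          t * (Complex.exp (A * ((k / L : ℝ) : ℂ)) - Complex.exp (A * t)) := by
        rw [hc, hg]
        ring
      rw [e5]
      refine (norm_add_le _ _).trans ?_
      rw [norm_mul, norm_mul, Complex.norm_real, Real.norm_of_nonneg ht0]
      calc _ ≤ 1 / L * Real.exp M + 1 * (Real.exp M * (M * (1 / L))) := by
            gcongr
            exact e1.trans (by gcongr)
        _ = _ := by ring
    rw [hlen, abs_of_pos (by positivity)] at h2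
    calc _ ≤ ‖(L : ℂ) ^ 2‖ * ((1 + M) * Real.exp M / L * (1 / L)) := by gcongr
      _ = _ := by
        rw [norm_pow, Complex.norm_natCast]
        field_simp
  rw [← hsum, Finset.mul_sum, ← Finset.sum_sub_distrib]
  refine (norm_sum_le_of_le _ hterm).trans ?_
  simp [mul_comm]

theorem norm_pow_sub_pow_le {β : ℝ} (hβ : 1 ≤ β) {p q : ℂ} (hp : ‖p‖ ≤ β) (hq : ‖q‖ ≤ β) (k : ℕ) :
    ‖p ^ k - q ^ k‖ ≤ k * β ^ k * ‖p - q‖ := by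
  induction k with
  | zero => simp
  | succ k ih =>
    have h : p ^ (k + 1) - q ^ (k + 1) = p * (p ^ k - q ^ k) + (p - q) * q ^ k := by ring
    have hqk : ‖q ^ k‖ ≤ β ^ (k + 1) := by
      rw [norm_pow]
      exact (pow_le_pow_left₀ (norm_nonneg _) hq k).trans (pow_le_pow_right₀ hβ k.le_succ)
    rw [h]
    refine (norm_add_le _ _).trans ?_
    rw [norm_mul, norm_mul]
    calc _ ≤ β * (k * β ^ k * ‖p - q‖) + ‖p - q‖ * β ^ (k + 1) := by gcongr
      _ = _ := by push_cast; ring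

/-- The sum of `(k + 1) * q ^ k` over `k < L` is `L ^ 2 * H A / 2 + O(L)` when
`q = 1 + A / L + O(1 / L ^ 2)`. -/
theorem exists_norm_sum_sub_le (M D : ℝ) (hM : 0 ≤ M) (hD : 0 ≤ D) :
    ∃ C : ℝ, ∀ L : ℕ, 0 < L → ∀ A q : ℂ, ‖A‖ ≤ M → ‖q - 1 - A / L‖ ≤ D / L ^ 2 →
      ‖∑ k ∈ Finset.range L, ((k : ℂ) + 1) * q ^ k - (L : ℂ) ^ 2 * (H A / 2)‖ ≤ C * L := by
  refine ⟨Real.exp (M + D) * (D + M ^ 2 * Real.exp M) + (1 + M) * Real.exp M,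
    fun L hL A q hA hq => ?_⟩
  have hL' : (1 : ℝ) ≤ L := by exact_mod_cast hL
  have hL0 : (0 : ℝ) < L := by linarith
  set p := Complex.exp (A / L) with hp_def
  set β := Real.exp ((M + D) / L) with hβ
  have hAL : ‖A / L‖ ≤ M / L := by
    rw [norm_div, Complex.norm_natCast]
    gcongr
  have hβ1 : 1 ≤ β := Real.one_le_exp (by positivity)
  have hp : ‖p‖ ≤ β := by
    refine (Complex.norm_exp_le_exp_norm _).trans (Real.exp_le_exp.2 (hAL.trans ?_))
    gcongr
    linarith
  have hq' : ‖q‖ ≤ β := by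
    have h1 : q = (q - 1 - A / L) + 1 + A / L := by ring
    have h2 : D / (L : ℝ) ^ 2 ≤ D / L := by
      gcongr
      nlinarith
    calc ‖q‖ ≤ ‖q - 1 - A / L‖ + ‖(1 : ℂ)‖ + ‖A / L‖ := by
          nth_rewrite 1 [h1]
          exact norm_add₃_le
      _ ≤ D / L + 1 + M / L := by
          rw [norm_one]
          gcongr
          exact hq.trans h2
      _ = (M + D) / L + 1 := by ring
      _ ≤ β := Real.add_one_le_exp _
  have hpq : ‖q - p‖ ≤ (D + M ^ 2 * Real.exp M) / L ^ 2 := by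
    have h1 := Complex.norm_exp_sub_sum_le_norm_mul_exp (A / L) 2
    have h2 : q - p = (q - 1 - A / L) - (Complex.exp (A / L) -
        ∑ j ∈ Finset.range 2, (A / L) ^ j / (j.factorial : ℂ)) := by
      simp [Finset.sum_range_succ, hp_def]
      ring
    rw [h2]
    refine (norm_sub_le _ _).trans ?_
    have hML : M / L ≤ M := div_le_self hM hL'
    calc _ ≤ D / L ^ 2 + (M / L) ^ 2 * Real.exp M := by
          refine add_le_add hq (h1.trans ?_)
          gcongr
          exact hAL.trans hML
      _ = _ := by ring
  have hdiff : ‖∑ k ∈ Finset.range L, ((k : ℂ) + 1) * q ^ k -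
      ∑ k ∈ Finset.range L, ((k : ℂ) + 1) * p ^ k‖
        ≤ Real.exp (M + D) * (D + M ^ 2 * Real.exp M) * L := by
    rw [← Finset.sum_sub_distrib]
    have hterm : ∀ k ∈ Finset.range L, ‖((k : ℂ) + 1) * q ^ k - ((k : ℂ) + 1) * p ^ k‖
        ≤ Real.exp (M + D) * (D + M ^ 2 * Real.exp M) := by
      intro k hk
      have hk1 : (k : ℝ) + 1 ≤ L := by exact_mod_cast Finset.mem_range.1 hk
      have hk2 : (k : ℝ) ≤ L := by linarith
      have hβk : β ^ k ≤ Real.exp (M + D) := by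
        rw [hβ, ← Real.exp_nat_mul]
        refine Real.exp_le_exp.2 ?_
        calc (k : ℝ) * ((M + D) / L) ≤ L * ((M + D) / L) := by gcongr
          _ = M + D := by field_simp
      have hk3 : ‖(k : ℂ) + 1‖ ≤ L := by
        have : (k : ℂ) + 1 = ((k + 1 : ℕ) : ℂ) := by push_cast; rfl
        rw [this, Complex.norm_natCast]
        exact_mod_cast hk1
      rw [← mul_sub, norm_mul]
      calc _ ≤ (L : ℝ) * (L * Real.exp (M + D) * ((D + M ^ 2 * Real.exp M) / L ^ 2)) := by
            refine mul_le_mul hk3 ((norm_pow_sub_pow_le hβ1 hq' hp k).trans ?_)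
              (norm_nonneg _) hL0.le
            gcongr
        _ = _ := by field_simp
    refine (norm_sum_le_of_le _ hterm).trans ?_
    simp [mul_comm]
  have := norm_sum_exp_sub_le hA hL
  calc _ ≤ _ := norm_sub_le_norm_sub_add_norm_sub _ (∑ k ∈ Finset.range L, ((k : ℂ) + 1) * p ^ k) _
    _ ≤ _ := add_le_add hdiff this
    _ = _ := by ring

theorem exists_norm_add_pow_sub_le (m : ℕ) (R : ℝ) (hR : 0 ≤ R) :
    ∃ C : ℝ, 0 ≤ C ∧ ∀ z h : ℂ, ‖z‖ ≤ R → ‖h‖ ≤ R →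
      ‖(z + h) ^ m - z ^ m - m * z ^ (m - 1) * h‖ ≤ C * ‖h‖ ^ 2 := by
  induction m with
  | zero => exact ⟨0, le_rfl, by simp⟩
  | succ m ih =>
    obtain ⟨C, hC, ih⟩ := ih
    refine ⟨2 * R * C + m * R ^ (m - 1), by positivity, fun z h hz hh => ?_⟩
    have h1 : (z + h) ^ (m + 1) - z ^ (m + 1) - ((m + 1 : ℕ) : ℂ) * z ^ (m + 1 - 1) * h =
        (z + h) * ((z + h) ^ m - z ^ m - m * z ^ (m - 1) * h) + m * z ^ (m - 1) * h ^ 2 := by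
      rcases m with _ | m
      · simp
      · push_cast
        ring
    have h2 : ‖z + h‖ ≤ 2 * R := (norm_add_le _ _).trans (by linarith)
    rw [h1]
    refine (norm_add_le _ _).trans ?_
    simp only [norm_mul, norm_pow, Complex.norm_natCast]
    calc _ ≤ 2 * R * (C * ‖h‖ ^ 2) + m * R ^ (m - 1) * ‖h‖ ^ 2 := by
          gcongr
          exact ih z h hz hh
      _ = _ := by ring

/-! ### Asymptotics of the model kernel -/

theorem isBigO_conj {ι : Type*} {l : Filter ι} {f : ι → ℂ} {g : ι → ℝ} (h : f =O[l] g) :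
    (fun i => conj (f i)) =O[l] g := by
  refine isBigO_norm_left.1 ?_
  simpa only [RCLike.norm_conj] using h.norm_left

section Scaling

variable {ι : Type*} {l : Filter ι} {N L : ι → ℕ} {z a b : ι → ℂ} {m : ℕ}

theorem isBigO_inv_natCast_one (hN : Tendsto N l atTop) :
    (fun i => (N i : ℝ)⁻¹) =O[l] (fun _ => (1 : ℝ)) :=
  (tendsto_inv_atTop_zero.comp (tendsto_natCast_atTop_atTop.comp hN)).isBigO_one ℝ

theorem isBigO_div_natCast (ha : a =O[l] (fun _ => (1 : ℝ))) :
    (fun i => a i / (N i : ℂ)) =O[l] (fun i => (N i : ℝ)⁻¹) := by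
  have h : (fun i => ((N i : ℂ))⁻¹) =O[l] (fun i => (N i : ℝ)⁻¹) :=
    IsBigO.of_norm_le fun i => by simp
  simpa only [div_eq_mul_inv, one_mul] using ha.mul h

theorem eventually_norm_div_natCast_le_two (hN : Tendsto N l atTop)
    (ha : a =O[l] (fun _ => (1 : ℝ))) : ∀ᶠ i in l, ‖a i / (N i : ℂ)‖ ≤ 2 := by
  have h : Tendsto (fun i => a i / (N i : ℂ)) l (𝓝 0) :=
    (isBigO_div_natCast ha).trans_tendsto
      (tendsto_inv_atTop_zero.comp (tendsto_natCast_atTop_atTop.comp hN))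
  have h2 := h.norm
  rw [norm_zero] at h2
  exact h2.eventually_le_const two_pos

theorem isBigO_add_pow_sub (hN : Tendsto N l atTop) (hz : ∀ᶠ i in l, ‖z i‖ ≤ 2)
    (ha : a =O[l] (fun _ => (1 : ℝ))) :
    (fun i => (z i + a i / N i) ^ m - z i ^ m - m * z i ^ (m - 1) * (a i / N i))
      =O[l] (fun i => (N i : ℝ)⁻¹ ^ 2) := by
  obtain ⟨C, -, hC⟩ := exists_norm_add_pow_sub_le m 2 zero_le_two
  have h1 : (fun i => (z i + a i / N i) ^ m - z i ^ m - m * z i ^ (m - 1) * (a i / N i))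
      =O[l] (fun i => (a i / (N i : ℂ)) ^ 2) := by
    refine IsBigO.of_bound C ?_
    filter_upwards [hz, eventually_norm_div_natCast_le_two hN ha] with i h2 h3
    rw [norm_pow]
    exact hC _ _ h2 h3
  exact h1.trans ((isBigO_div_natCast ha).pow 2)

theorem isBigO_add_pow_sub_pow (hN : Tendsto N l atTop) (hz : ∀ᶠ i in l, ‖z i‖ ≤ 2)
    (ha : a =O[l] (fun _ => (1 : ℝ))) (k : ℕ) :
    (fun i => (z i + a i / N i) ^ k - z i ^ k) =O[l] (fun i => (N i : ℝ)⁻¹) := by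
  have h1 : (fun i => (z i + a i / N i) ^ k - z i ^ k) =O[l] (fun i => a i / (N i : ℂ)) := by
    refine IsBigO.of_bound (k * 4 ^ k) ?_
    filter_upwards [hz, eventually_norm_div_natCast_le_two hN ha] with i h2 h3
    have h := norm_pow_sub_pow_le (β := 4) (by norm_num)
      ((norm_add_le (z i) (a i / N i)).trans (by linarith)) (h2.trans (by norm_num)) k
    rwa [add_sub_cancel_left] at h
  exact h1.trans (isBigO_div_natCast ha)

theorem isBigO_pow_one (hz : ∀ᶠ i in l, ‖z i‖ ≤ 2) (k : ℕ) :
    (fun i => z i ^ k) =O[l] (fun _ => (1 : ℝ)) := by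
  have h1 : z =O[l] (fun _ => (1 : ℝ)) := IsBigO.of_bound 2 (by simpa using hz)
  simpa using h1.pow k

variable {r : ℝ}

theorem norm_w₀_eq_one (hr0 : 0 < r) {x : ℂ} (hx : ‖x ^ m - 1‖ = r ^ m) : ‖w₀ r m x‖ = 1 := by
  rw [w₀, norm_div, hx, norm_pow, Complex.norm_real, Real.norm_of_nonneg hr0.le,
    div_self (pow_pos hr0 m).ne']

/-- First-order expansion of the product that is raised to the powers `k` in the disk kernel. -/
theorem isBigO_product_sub (hr0 : 0 < r) (hr1 : r < 1) (hm : m ≠ 0) (hN : Tendsto N l atTop)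
    (hz : ∀ᶠ i in l, ‖z i ^ m - 1‖ = r ^ m) (ha : a =O[l] (fun _ => (1 : ℝ)))
    (hb : b =O[l] (fun _ => (1 : ℝ))) :
    (fun i => ((z i + a i / N i) ^ m - 1) / (r ^ m : ℝ) *
        conj (((z i + b i / N i) ^ m - 1) / (r ^ m : ℝ)) - 1 - m * A r m (z i) (a i) (b i) / N i)
      =O[l] (fun i => (N i : ℝ)⁻¹ ^ 2) := by
  have hr : (r : ℂ) ≠ 0 := by exact_mod_cast hr0.ne'
  have hz2 : ∀ᶠ i in l, ‖z i‖ ≤ 2 := hz.mono fun i hi =>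
    norm_le_two hm (hi.le.trans (pow_le_one₀ hr0.le hr1.le))
  have hlin : ∀ c : ι → ℂ, c =O[l] (fun _ => (1 : ℝ)) →
      (fun i => m * z i ^ (m - 1) * (c i / N i) / (r : ℂ) ^ m) =O[l] (fun i => (N i : ℝ)⁻¹) := by
    intro c hc
    have h := (((isBigO_pow_one hz2 (m - 1)).const_mul_left (m : ℂ)).mul
      (isBigO_div_natCast (N := N) hc)).const_mul_left ((r : ℂ) ^ m)⁻¹
    simpa only [one_mul, div_eq_inv_mul, mul_assoc] using h
  have hrem : ∀ c : ι → ℂ, c =O[l] (fun _ => (1 : ℝ)) →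
      (fun i => ((z i + c i / N i) ^ m - z i ^ m - m * z i ^ (m - 1) * (c i / N i)) / (r : ℂ) ^ m)
        =O[l] (fun i => (N i : ℝ)⁻¹ ^ 2) := by
    intro c hc
    have h := (isBigO_add_pow_sub (m := m) hN hz2 hc).const_mul_left ((r : ℂ) ^ m)⁻¹
    simpa only [div_eq_inv_mul] using h
  have hw : (fun i => w₀ r m (z i)) =O[l] (fun _ => (1 : ℝ)) :=
    IsBigO.of_bound 1 (hz.mono fun i hi => by simp [norm_w₀_eq_one hr0 hi])
  have hg1 := isBigO_inv_natCast_one hN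
  have hg2 : (fun i => (N i : ℝ)⁻¹ ^ 2) =O[l] (fun _ => (1 : ℝ)) := by
    simpa using hg1.pow 2
  set α := fun i => m * z i ^ (m - 1) * (a i / N i) / (r : ℂ) ^ m
  set β := fun i => m * z i ^ (m - 1) * (b i / N i) / (r : ℂ) ^ m
  set f₁ := fun i => ((z i + a i / N i) ^ m - z i ^ m - m * z i ^ (m - 1) * (a i / N i)) /
    (r : ℂ) ^ m
  set f₂ := fun i => ((z i + b i / N i) ^ m - z i ^ m - m * z i ^ (m - 1) * (b i / N i)) /
    (r : ℂ) ^ m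
  have hα : α =O[l] (fun i => (N i : ℝ)⁻¹) := hlin a ha
  have hβ : β =O[l] (fun i => (N i : ℝ)⁻¹) := hlin b hb
  have hf₁ : f₁ =O[l] (fun i => (N i : ℝ)⁻¹ ^ 2) := hrem a ha
  have hf₂ : f₂ =O[l] (fun i => (N i : ℝ)⁻¹ ^ 2) := hrem b hb
  have t1 : (fun i => α i * conj (β i)) =O[l] (fun i => (N i : ℝ)⁻¹ ^ 2) := by
    simpa only [sq] using hα.mul (isBigO_conj hβ)
  have t2 : (fun i => (w₀ r m (z i) + α i) * conj (f₂ i)) =O[l] (fun i => (N i : ℝ)⁻¹ ^ 2) := by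
    simpa only [one_mul] using (hw.add (hα.trans hg1)).mul (isBigO_conj hf₂)
  have t3 : (fun i => f₁ i * conj (w₀ r m (z i) + β i + f₂ i))
      =O[l] (fun i => (N i : ℝ)⁻¹ ^ 2) := by
    simpa only [mul_one] using
      hf₁.mul (isBigO_conj ((hw.add (hβ.trans hg1)).add (hf₂.trans hg2)))
  refine ((t1.add t2).add t3).congr' ?_ EventuallyEq.rfl
  filter_upwards [hz] with i hi
  have hww : w₀ r m (z i) * conj (w₀ r m (z i)) = 1 := by
    rw [Complex.mul_conj, Complex.normSq_eq_norm_sq, norm_w₀_eq_one hr0 hi]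
    simp
  have e1 : ∀ c : ℂ, ((z i + c / N i) ^ m - 1) / ((r ^ m : ℝ) : ℂ) = w₀ r m (z i) +
      m * z i ^ (m - 1) * (c / N i) / (r : ℂ) ^ m +
      ((z i + c / N i) ^ m - z i ^ m - m * z i ^ (m - 1) * (c / N i)) / (r : ℂ) ^ m := by
    intro c
    rw [w₀]
    push_cast
    ring
  have e2 : m * A r m (z i) (a i) (b i) / N i
      = conj (w₀ r m (z i)) * α i + w₀ r m (z i) * conj (β i) := by
    simp only [A, α, β, map_mul, map_div₀, map_pow, Complex.conj_ofReal, map_natCast]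
    ring
  have e3 := e1 (a i)
  have e4 := e1 (b i)
  rw [show m * z i ^ (m - 1) * (a i / N i) / (r : ℂ) ^ m = α i from rfl,
    show ((z i + a i / N i) ^ m - z i ^ m - m * z i ^ (m - 1) * (a i / N i)) / (r : ℂ) ^ m = f₁ i
      from rfl] at e3
  rw [show m * z i ^ (m - 1) * (b i / N i) / (r : ℂ) ^ m = β i from rfl,
    show ((z i + b i / N i) ^ m - z i ^ m - m * z i ^ (m - 1) * (b i / N i)) / (r : ℂ) ^ m = f₂ i
      from rfl] at e4
  rw [e3, e4, e2]
  simp only [map_add]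
  linear_combination -hww

theorem norm_A_le (hr0 : 0 < r) {x a b : ℂ} (hx : ‖x ^ m - 1‖ = r ^ m) (hx2 : ‖x‖ ≤ 2) :
    ‖A r m x a b‖ ≤ (‖a‖ + ‖b‖) * 2 ^ (m - 1) / r ^ m := by
  rw [A, norm_div, norm_pow, Complex.norm_real, Real.norm_of_nonneg hr0.le]
  have h := norm_w₀_eq_one hr0 hx
  refine div_le_div_of_nonneg_right ((norm_add_le _ _).trans ?_) (by positivity)
  simp only [norm_mul, norm_pow, RCLike.norm_conj, h, one_mul]
  calc _ ≤ ‖a‖ * 2 ^ (m - 1) + ‖b‖ * 2 ^ (m - 1) := by gcongr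
    _ = _ := by ring

/-- Universality for the model kernel near boundary points. -/
theorem isBigO_modelKernel_sub (hr0 : 0 < r) (hr1 : r < 1) (hm : m ≠ 0) (hN : Tendsto N l atTop)
    (hz : ∀ᶠ i in l, ‖z i ^ m - 1‖ = r ^ m) (ha : a =O[l] (fun _ => (1 : ℝ)))
    (hb : b =O[l] (fun _ => (1 : ℝ))) {e : ℝ} (hL : ∀ᶠ i in l, |(m : ℝ) * L i - N i| ≤ e) :
    (fun i => modelKernel (r ^ m) m (L i) (z i + a i / N i) (z i + b i / N i) -
      (N i : ℂ) ^ 2 * H (A r m (z i) (a i) (b i)) *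
        ((‖z i‖ ^ (2 * m - 2) / (2 * Real.pi * r ^ (2 * m)) : ℝ) : ℂ))
      =O[l] (fun i => (N i : ℝ)) := by
  have hm1 : (1 : ℝ) ≤ m := by exact_mod_cast Nat.one_le_iff_ne_zero.2 hm
  have hz2 : ∀ᶠ i in l, ‖z i‖ ≤ 2 := hz.mono fun i hi =>
    norm_le_two hm (hi.le.trans (pow_le_one₀ hr0.le hr1.le))
  have hNR : Tendsto (fun i => (N i : ℝ)) l atTop := tendsto_natCast_atTop_atTop.comp hN
  have hN1 : ∀ᶠ i in l, (N i : ℝ) ≥ 1 + |e| := hNR.eventually_ge_atTop _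
  have hLpos : ∀ᶠ i in l, 0 < L i := by
    filter_upwards [hN1, hL] with i h1 h2
    have h3 := (abs_le.1 h2).1
    have h4 : (0 : ℝ) < m * L i := by linarith [le_abs_self e]
    exact_mod_cast pos_of_mul_pos_right h4 (by linarith)
  have hLN : ∀ᶠ i in l, (L i : ℝ) ≤ 2 * N i := by
    filter_upwards [hN1, hL] with i h1 h2
    have h3 := (abs_le.1 h2).2
    nlinarith [le_abs_self e, Nat.cast_nonneg (α := ℝ) (L i)]
  set As := fun i => A r m (z i) (a i) (b i)
  obtain ⟨Ca, hCa⟩ := ha.bound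
  obtain ⟨Cb, hCb⟩ := hb.bound
  obtain ⟨M, hM0, hM⟩ : ∃ M : ℝ, 0 ≤ M ∧ ∀ᶠ i in l, ‖As i‖ ≤ M := by
    refine ⟨|(Ca + Cb) * 2 ^ (m - 1) / r ^ m|, abs_nonneg _, ?_⟩
    filter_upwards [hz, hz2, hCa, hCb] with i h1 h2 h3 h4
    refine (norm_A_le hr0 h1 h2).trans (le_trans ?_ (le_abs_self _))
    simp only [norm_one, mul_one] at h3 h4
    gcongr
  have hA : As =O[l] (fun _ => (1 : ℝ)) := IsBigO.of_bound M (by simpa using hM)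
  have hH : (fun i => H (As i)) =O[l] (fun _ => (1 : ℝ)) :=
    IsBigO.of_bound (2 * Real.exp M) (hM.mono fun i hi => by simpa using norm_H_le hi)
  set q := fun i => ((z i + a i / N i) ^ m - 1) / ((r ^ m : ℝ) : ℂ) *
    conj (((z i + b i / N i) ^ m - 1) / ((r ^ m : ℝ) : ℂ))
  have hq := isBigO_product_sub hr0 hr1 hm hN hz ha hb
  have hgap : (fun i => ((m : ℂ) * L i - N i)) =O[l] (fun _ => (1 : ℝ)) := by
    refine IsBigO.of_bound e (hL.mono fun i hi => ?_)
    have : (m : ℂ) * L i - N i = (((m : ℝ) * L i - N i : ℝ) : ℂ) := by push_cast; rfl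
    rw [this, Complex.norm_real, Real.norm_eq_abs]
    simpa using hi
  have hLinv : (fun i => ((L i : ℂ))⁻¹) =O[l] (fun i => (N i : ℝ)⁻¹) := by
    refine IsBigO.of_bound (m + |e|) ?_
    filter_upwards [hLpos, hL, hN1] with i h1 h2 h3
    have h4 : (1 : ℝ) ≤ L i := by exact_mod_cast h1
    have h5 := (abs_le.1 h2).1
    rw [norm_inv, Complex.norm_natCast, norm_inv, Real.norm_natCast, ← div_eq_mul_inv,
      inv_eq_one_div, div_le_div_iff₀ (by linarith) (by linarith [abs_nonneg e])]
    nlinarith [le_abs_self e, abs_nonneg e]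
  have hqL : (fun i => q i - 1 - As i / L i) =O[l] (fun i => (N i : ℝ)⁻¹ ^ 2) := by
    have h1 : (fun i => (As i * ((m : ℂ) * L i - N i)) / N i * (L i : ℂ)⁻¹)
        =O[l] (fun i => (N i : ℝ)⁻¹ ^ 2) := by
      have h2 : (fun i => As i * ((m : ℂ) * L i - N i)) =O[l] (fun _ => (1 : ℝ)) := by
        simpa using hA.mul hgap
      simpa only [sq] using (isBigO_div_natCast (N := N) h2).mul hLinv
    refine (hq.add h1).congr' ?_ EventuallyEq.rfl
    filter_upwards [hLpos, hN1] with i h2 h3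
    have h4 : (L i : ℂ) ≠ 0 := by exact_mod_cast h2.ne'
    have h5 : (N i : ℝ) ≠ 0 := by linarith [abs_nonneg e]
    have h5' : (N i : ℂ) ≠ 0 := by exact_mod_cast h5
    simp only [q, As]
    field_simp
    ring
  set S := fun i => ∑ k ∈ Finset.range (L i), ((k : ℂ) + 1) * q i ^ k
  have hS : (fun i => S i - (L i : ℂ) ^ 2 * (H (As i) / 2)) =O[l] (fun i => (N i : ℝ)) := by
    obtain ⟨D, hD, hDb⟩ := hqL.exists_nonneg
    obtain ⟨C, hC⟩ := exists_norm_sum_sub_le M (4 * D) hM0 (by positivity)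
    refine IsBigO.of_bound (2 * |C|) ?_
    filter_upwards [hDb.bound, hM, hLpos, hLN, hN1] with i h1 h2 h3 h4 h5
    have h3' : (0 : ℝ) < L i := by exact_mod_cast h3
    have h6 : (0 : ℝ) < N i := by linarith [abs_nonneg e]
    have h7 := hC (L i) h3 (As i) (q i) h2 (h1.trans (by
      rw [norm_pow, norm_inv, Real.norm_natCast, inv_pow, ← div_eq_mul_inv,
        div_le_div_iff₀ (by positivity) (by positivity)]
      nlinarith [mul_nonneg hD (sub_nonneg.2 (pow_le_pow_left₀ h3'.le h4 2))]))
    refine h7.trans ?_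
    rw [Real.norm_natCast]
    calc C * (L i : ℝ) ≤ |C| * (2 * N i) := by gcongr; exact le_abs_self C
      _ = _ := by ring
  have hgN : (fun i => (N i : ℝ)⁻¹ * (N i : ℝ) ^ 2) =O[l] (fun i => (N i : ℝ)) := by
    refine IsBigO.of_norm_le fun i => ?_
    rcases eq_or_ne (N i : ℝ) 0 with h | h
    · simp [h]
    · rw [sq, inv_mul_cancel_left₀ h]
      simp
  have hNc : (fun i => (N i : ℂ)) =O[l] (fun i => (N i : ℝ)) := IsBigO.of_norm_le fun i => by simp
  have h1N : (fun _ => (1 : ℝ)) =O[l] (fun i => (N i : ℝ)) := by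
    refine IsBigO.of_bound 1 (hN1.mono fun i hi => ?_)
    rw [norm_one, one_mul, Real.norm_natCast]
    linarith [abs_nonneg e]
  have hS2 : (fun i => (m : ℂ) ^ 2 * S i - (N i : ℂ) ^ 2 * (H (As i) / 2))
      =O[l] (fun i => (N i : ℝ)) := by
    have h1 : (fun i => ((m : ℂ) * L i - N i) * (((m : ℂ) * L i - N i) + 2 * N i) * (H (As i) / 2))
        =O[l] (fun i => (N i : ℝ)) := by
      have h2 : (fun i => H (As i) / 2) =O[l] (fun _ => (1 : ℝ)) := by
        simpa only [div_eq_inv_mul] using hH.const_mul_left (2 : ℂ)⁻¹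
      have h3 : (fun i => ((m : ℂ) * L i - N i) + 2 * N i) =O[l] (fun i => (N i : ℝ)) :=
        (hgap.trans h1N).add (hNc.const_mul_left 2)
      simpa using (hgap.mul h3).mul h2
    refine ((hS.const_mul_left ((m : ℂ) ^ 2)).add h1).congr_left fun i => ?_
    ring
  -- The prefactors converge with rate `1 / N`.
  set X := fun i => (z i + a i / N i) ^ (m - 1) * conj ((z i + b i / N i) ^ (m - 1))
  set X₀ := fun i => z i ^ (m - 1) * conj (z i ^ (m - 1))
  have hp := isBigO_pow_one hz2 (m - 1)
  have hpa := isBigO_add_pow_sub_pow hN hz2 ha (m - 1)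
  have hpb := isBigO_add_pow_sub_pow hN hz2 hb (m - 1)
  have hg1 := isBigO_inv_natCast_one hN
  have hXX : (fun i => X i - X₀ i) =O[l] (fun i => (N i : ℝ)⁻¹) := by
    have h1 := hpa.mul (isBigO_conj ((hpb.trans hg1).add hp))
    have h2 := hp.mul (isBigO_conj hpb)
    simp only [mul_one, one_mul] at h1 h2
    refine (h1.add h2).congr_left fun i => ?_
    simp only [X, X₀, map_add, map_sub]
    ring
  have hX : X =O[l] (fun _ => (1 : ℝ)) := by
    have h1 : X₀ =O[l] (fun _ => (1 : ℝ)) := by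
      simpa only [mul_one] using hp.mul (isBigO_conj hp)
    refine ((hXX.trans hg1).add h1).congr_left fun i => ?_
    ring
  have hfin : (fun i => X i * ((m : ℂ) ^ 2 * S i - (N i : ℂ) ^ 2 * (H (As i) / 2)) +
      (X i - X₀ i) * (N i : ℂ) ^ 2 * (H (As i) / 2)) =O[l] (fun i => (N i : ℝ)) := by
    have h1 := hX.mul hS2
    have h2 : (fun i => H (As i) / 2) =O[l] (fun _ => (1 : ℝ)) := by
      simpa only [div_eq_inv_mul] using hH.const_mul_left (2 : ℂ)⁻¹
    have h3 := (hXX.mul (hNc.pow 2)).mul h2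
    simp only [mul_one, one_mul] at h1 h3
    exact h1.add (h3.trans hgN)
  refine (hfin.const_mul_left (1 / (Real.pi * r ^ (2 * m)) : ℂ)).congr_left fun i => ?_
  have hX₀ : ((‖z i‖ ^ (2 * m - 2) / (2 * Real.pi * r ^ (2 * m)) : ℝ) : ℂ) =
      X₀ i / (2 * Real.pi * r ^ (2 * m)) := by
    have h1 : 2 * m - 2 = (m - 1) * 2 := by omega
    simp only [X₀]
    rw [Complex.mul_conj, Complex.normSq_eq_norm_sq, norm_pow, h1, pow_mul]
    push_cast
    rfl
  have hdisk : diskKernel (r ^ m) (L i) ((z i + a i / N i) ^ m) ((z i + b i / N i) ^ m)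
      = 1 / (Real.pi * r ^ (2 * m)) * S i := by
    simp only [diskKernel, S, Finset.mul_sum, q]
    refine Finset.sum_congr rfl fun k _ => ?_
    rw [show (((r ^ m : ℝ) : ℂ)) ^ 2 = (r : ℂ) ^ (2 * m) by push_cast; ring]
    ring
  rw [hX₀, modelKernel, hdisk]
  simp only [X, X₀, As, map_mul, map_natCast]
  ring

end Scaling

theorem eventually_norm_modelKernel_sub_le {r : ℝ} (hr0 : 0 < r) (hr1 : r < 1) {m : ℕ}
    (hm : m ≠ 0) {L : ℕ → ℕ} {e : ℝ} (hL : ∀ᶠ n in atTop, |(m : ℝ) * L n - n| ≤ e) (R : ℝ)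
    {η : ℝ} (hη : 0 < η) :
    ∀ᶠ n : ℕ in atTop, ∀ z a b : ℂ, ‖z ^ m - 1‖ = r ^ m → ‖a‖ ≤ R → ‖b‖ ≤ R →
      ‖modelKernel (r ^ m) m (L n) (z + a / n) (z + b / n) - (n : ℂ) ^ 2 * H (A r m z a b) *
        ((‖z‖ ^ (2 * m - 2) / (2 * Real.pi * r ^ (2 * m)) : ℝ) : ℂ)‖ ≤ η * (n : ℝ) ^ 2 := by
  set s : Set (ℂ × ℂ × ℂ) := {p | ‖p.1 ^ m - 1‖ = r ^ m ∧ ‖p.2.1‖ ≤ R ∧ ‖p.2.2‖ ≤ R}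
  set l : Filter (ℕ × ℂ × ℂ × ℂ) := atTop ×ˢ 𝓟 s
  have hN : Tendsto (fun p : ℕ × ℂ × ℂ × ℂ => p.1) l atTop := tendsto_fst
  have hs : ∀ᶠ p in l, p.2 ∈ s := tendsto_snd.eventually (eventually_mem_principal s)
  have h := isBigO_modelKernel_sub (N := fun p : ℕ × ℂ × ℂ × ℂ => p.1) (z := fun p => p.2.1)
    (a := fun p => p.2.2.1) (b := fun p => p.2.2.2) (L := fun p => L p.1) hr0 hr1 hm hN
    (hs.mono fun p hp => hp.1)
    (IsBigO.of_bound R (hs.mono fun p hp => by simpa using hp.2.1))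
    (IsBigO.of_bound R (hs.mono fun p hp => by simpa using hp.2.2)) (hN.eventually hL)
  have ho : (fun p : ℕ × ℂ × ℂ × ℂ => (p.1 : ℝ)) =o[l] (fun p => (p.1 : ℝ) ^ 2) := by
    have : (fun x : ℝ => x) =o[atTop] (fun x => x ^ 2) := by
      simpa using isLittleO_pow_pow_atTop_of_lt (𝕜 := ℝ) one_lt_two
    exact this.comp_tendsto (tendsto_natCast_atTop_atTop.comp hN)
  have hb := (h.trans_isLittleO ho).bound hη
  rw [eventually_prod_principal_iff] at hb
  filter_upwards [hb] with n hn z a b h1 h2 h3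
  simpa using hn (z, a, b) ⟨h1, h2, h3⟩

theorem eventually_norm_eval_add_div_sub_le (p : ℂ[X]) (R : ℝ) {η : ℝ} (hη : 0 < η) :
    ∀ᶠ n : ℕ in atTop, ∀ z a : ℂ, ‖z‖ ≤ 2 → ‖a‖ ≤ R →
      ‖p.eval (z + a / n) - p.eval z‖ ≤ η := by
  have huc := (isCompact_closedBall (0 : ℂ) 3).uniformContinuousOn_of_continuous
    (f := fun z => p.eval z) (by fun_prop)
  rw [Metric.uniformContinuousOn_iff_le] at huc
  obtain ⟨δ, hδ, h⟩ := huc η hη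
  have hlim : Tendsto (fun n : ℕ => R / n) atTop (𝓝 0) := tendsto_const_div_atTop_nhds_zero_nat R
  filter_upwards [hlim.eventually_le_const hδ, hlim.eventually_le_const one_pos]
    with n h1 h2 z a hz ha
  have h3 : ‖a / (n : ℂ)‖ ≤ R / n := by
    rw [norm_div, Complex.norm_natCast]
    gcongr
  have h4 := h (z + a / n) (by
    rw [mem_closedBall_zero_iff]
    exact (norm_add_le _ _).trans (by linarith)) z (by
    rw [mem_closedBall_zero_iff]
    linarith) (by
    rw [dist_eq_norm, add_sub_cancel_left]
    exact h3.trans h1)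
  rwa [dist_eq_norm] at h4

/-! ### Comparison of the two kernels -/

/-- The factors in `kernel_self_le` amount to a relative error of order `η`. -/
theorem le_of_mul_one_sub_sq_le {m η K E : ℝ} (hm : 1 ≤ m) (hη : 0 ≤ η) (hmη : m * η ≤ 1 / 4)
    (hE : 0 ≤ E) (h : K * (1 - m * η) ^ 2 ≤ (1 + η + (η + η ^ 2) * m ^ 2) * E) :
    K ≤ (1 + 10 * m ^ 2 * η) * E := by
  set x := m * η with hx
  have hx0 : 0 ≤ x := by positivity
  have hηx : η ≤ x := le_mul_of_one_le_left hη hm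
  have hmx : x ≤ m * x := le_mul_of_one_le_left hx0 hm
  have h1 : 1 + η + (η + η ^ 2) * m ^ 2 ≤ (1 - x) ^ 2 * (1 + 10 * m ^ 2 * η) := by
    have e1 : (η + η ^ 2) * m ^ 2 = m * x + x ^ 2 := by rw [hx]; ring
    have e2 : 10 * m ^ 2 * η = 10 * (m * x) := by rw [hx]; ring
    rw [e1, e2]
    nlinarith [mul_nonneg (hx0.trans hmx) (sub_nonneg.2 hmη), mul_nonneg hx0 (sub_nonneg.2 hmη),
      mul_nonneg (hx0.trans hmx) (sq_nonneg x)]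
  have hpos : 0 < (1 - x) ^ 2 := by
    have : 0 < 1 - x := by linarith
    positivity
  refine le_of_mul_le_mul_right (h.trans ((mul_le_mul_of_nonneg_right h1 hE).trans ?_)) hpos
  linarith

/-- The last factor in `OrthPoly.norm_sq_kernel_sub_eval_le` is small when the model kernels that
bound `Kw` from above and below both lie near `t`. -/
theorem sub_add_le_of_near {κ η B n2 t Kw Ep Em Pw I : ℝ} (hκ : 0 ≤ κ) (hη : 0 ≤ η) (hB : 0 ≤ B)
    (hn2 : 0 ≤ n2) (hKw : Kw ≤ (1 + κ * η) * Ep) (hEp : Ep ≤ t + η * n2)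
    (hEm : t - η * n2 ≤ Em) (hEpB : Ep ≤ (B + 1) * n2) (hEmB : Em ≤ (B + 1) * n2)
    (hPw : (1 - 2 * η) * Em ≤ Pw) (hI : I ≤ (1 + 3 * η) * Em) :
    Kw - 2 * Pw + I ≤ (κ + 9) * (B + 1) * η * n2 := by
  have h1 : κ * η * Ep ≤ κ * η * ((B + 1) * n2) := by gcongr
  have h2 : 7 * η * Em ≤ 7 * η * ((B + 1) * n2) := by gcongr
  have h3 : 0 ≤ B * η * n2 := by positivity
  linarith

/-- Boundary points of the region lie on the lemniscate. -/
theorem norm_pow_sub_one_eq_of_mem_frontier {r : ℝ} {m : ℕ} {z : ℂ}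
    (hz : z ∈ frontier (region r m)) : ‖z ^ m - 1‖ = r ^ m :=
  frontier_lt_subset_eq (f := fun z : ℂ => ‖z ^ m - 1‖) (by fun_prop) continuous_const hz

end Lemniscate

open Lemniscate Polynomial MeasureTheory Filter Topology in
open scoped Classical in
theorem theorem3p5 (r : ℝ) (hr0 : 0 < r) (hr1 : r < 1) (m : ℕ) (hm : 1 ≤ m)
    (J : Set ℂ) (hJ : IsCompact J) (hJG : J ⊆ frontier (Lemniscate.region r m))
    (S T : Set ℂ) (hS : IsCompact S) (hT : IsCompact T) :
    ∀ ε : ℝ, 0 < ε → ∃ N : ℕ, ∀ n : ℕ, N ≤ n → ∀ z₀ ∈ J, ∀ a ∈ S, ∀ b ∈ T,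
      ‖OrthPoly.kernel (Lemniscate.areaMeasure r m) n (z₀ + a / (n : ℂ)) (z₀ + b / (n : ℂ))
          - (n : ℂ) ^ 2 * Lemniscate.H (Lemniscate.A r m z₀ a b)
            * (((‖z₀‖ ^ (2 * m - 2) / (2 * Real.pi * r ^ (2 * m)) : ℝ)) : ℂ)‖
        ≤ ε * (n : ℝ) ^ 2 := by
  intro ε hε
  have hm0 : m ≠ 0 := by omega
  have hm1 : (1 : ℝ) ≤ m := by exact_mod_cast hm
  have hρ1 : r ^ m < 1 := pow_lt_one₀ hr0.le hr1 hm0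
  have hρ0 : 0 < r ^ m := pow_pos hr0 m
  have := isFiniteMeasure_areaMeasure hr0 hr1 hm0
  obtain ⟨R, hR⟩ := (hS.union hT).isBounded.exists_norm_le
  -- A bound for the limit function.
  set ℓ : ℂ → ℂ → ℂ → ℂ := fun z a b => H (A r m z a b) *
    ((‖z‖ ^ (2 * m - 2) / (2 * Real.pi * r ^ (2 * m)) : ℝ) : ℂ)
  obtain ⟨B, hB0, hB⟩ : ∃ B : ℝ, 0 ≤ B ∧ ∀ z a b : ℂ, ‖z ^ m - 1‖ = r ^ m → ‖a‖ ≤ R → ‖b‖ ≤ R →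
      ‖ℓ z a b‖ ≤ B := by
    have hpi := Real.pi_pos
    refine ⟨2 * Real.exp ((R + R) * 2 ^ (m - 1) / r ^ m) *
      (2 ^ (2 * m - 2) / (2 * Real.pi * r ^ (2 * m))), by positivity, fun z a b hz ha hb => ?_⟩
    have hz2 := norm_le_two hm0 (hz.le.trans hρ1.le)
    have h1 := norm_A_le (a := a) (b := b) hr0 hz hz2
    rw [norm_mul, Complex.norm_real, Real.norm_of_nonneg (by positivity)]
    refine mul_le_mul (norm_H_le (h1.trans ?_)) ?_ (by positivity) (by positivity)
    · gcongr
    · gcongr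
  set κ : ℝ := 10 * (m : ℝ) ^ 2
  have hκ : 0 ≤ κ := by positivity
  -- The accuracy `η` of the approximation of the indicator functions of the sheets.
  obtain ⟨η, hη, hη1, hmη, hη2, hη3⟩ : ∃ η : ℝ, 0 < η ∧ η ≤ 1 ∧ m * η ≤ 1 / 4 ∧
      ((1 + κ) * (B + 1)) * ((κ + 9) * (B + 1) * η) ≤ (ε / 2) ^ 2 ∧
      2 * η * (B + 1) + η ≤ ε / 2 := by
    have c1 : 0 < ((1 + κ) * (B + 1)) * ((κ + 9) * (B + 1)) := by positivity
    have c2 : 0 < 2 * (B + 1) + 1 := by positivity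
    refine ⟨min (1 / (4 * m)) (min ((ε / 2) ^ 2 / (((1 + κ) * (B + 1)) * ((κ + 9) * (B + 1))))
      (ε / 2 / (2 * (B + 1) + 1))), by positivity, ?_, ?_, ?_, ?_⟩
    · refine (min_le_left _ _).trans ?_
      rw [div_le_one (by positivity)]
      linarith
    · refine (mul_le_mul_of_nonneg_left (min_le_left _ _) (by positivity)).trans ?_
      apply le_of_eq
      field_simp
    · have h := (min_le_right (1 / (4 * (m : ℝ))) _).trans (min_le_left
        ((ε / 2) ^ 2 / (((1 + κ) * (B + 1)) * ((κ + 9) * (B + 1)))) (ε / 2 / (2 * (B + 1) + 1)))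
      rw [le_div_iff₀ c1] at h
      linarith
    · have h := (min_le_right (1 / (4 * (m : ℝ))) _).trans (min_le_right
        ((ε / 2) ^ 2 / (((1 + κ) * (B + 1)) * ((κ + 9) * (B + 1)))) (ε / 2 / (2 * (B + 1) + 1)))
      rw [le_div_iff₀ c2] at h
      linarith
  set s : ℝ := (1 + r ^ m) / 2 with hs_def
  have hs1 : s < 1 := by rw [hs_def]; linarith
  have hρs : r ^ m < s := by rw [hs_def]; linarith
  choose! θ hθ using fun ζ (hζ : ζ ^ m = 1) =>
    exists_polynomial_near_indicator hm0 (hρ0.le.trans hρs.le) hs1 hη hζ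
  set d := (nthRootsFinset m (1 : ℂ)).sup fun ζ => (θ ζ).natDegree with hd_def
  have hmem : ∀ ζ : ℂ, ζ ^ m = 1 → ζ ∈ nthRootsFinset m (1 : ℂ) := fun ζ hζ =>
    (mem_nthRootsFinset hm _).2 hζ
  have hd : ∀ ζ : ℂ, ζ ^ m = 1 → (θ ζ).natDegree ≤ d := fun ζ hζ =>
    Finset.le_sup (f := fun ζ => (θ ζ).natDegree) (hmem ζ hζ)
  -- Degrees of the model kernels that bound the kernel from above and from below.
  have hLp : ∀ᶠ n : ℕ in atTop, |(m : ℝ) * (((n + d) / m + 1 : ℕ) : ℝ) - n| ≤ d + 2 * m := by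
    refine Eventually.of_forall fun n => ?_
    have h1 := Nat.div_add_mod (n + d) m
    have h2 := Nat.mod_lt (n + d) hm
    have h3 : (m : ℝ) * ((n + d) / m : ℕ) + ((n + d) % m : ℕ) = n + d := by exact_mod_cast h1
    have h4 : (((n + d) % m : ℕ) : ℝ) ≤ m := by exact_mod_cast h2.le
    have h5 : (0 : ℝ) ≤ (((n + d) % m : ℕ) : ℝ) := Nat.cast_nonneg _
    have h6 : (0 : ℝ) ≤ d := Nat.cast_nonneg _
    rw [abs_le]
    push_cast
    constructor <;> linarith
  have hLm : ∀ᶠ n : ℕ in atTop, |(m : ℝ) * (((n - (d + 2 * m)) / m : ℕ) : ℝ) - n|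
      ≤ d + 3 * m := by
    filter_upwards [eventually_ge_atTop (d + 2 * m)] with n hn
    have h1 := Nat.div_add_mod (n - (d + 2 * m)) m
    have h2 := Nat.mod_lt (n - (d + 2 * m)) hm
    have h3 : (m : ℝ) * ((n - (d + 2 * m)) / m : ℕ) + ((n - (d + 2 * m)) % m : ℕ)
        = n - (d + 2 * m) := by
      have : ((n - (d + 2 * m) : ℕ) : ℝ) = n - (d + 2 * m) := by
        rw [Nat.cast_sub hn]
        push_cast
        ring
      rw [← this]
      exact_mod_cast h1
    have h4 : (((n - (d + 2 * m)) % m : ℕ) : ℝ) ≤ m := by exact_mod_cast h2.le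
    have h5 : (0 : ℝ) ≤ (((n - (d + 2 * m)) % m : ℕ) : ℝ) := Nat.cast_nonneg _
    have h6 : (0 : ℝ) ≤ d := Nat.cast_nonneg _
    rw [abs_le]
    constructor <;> linarith
  have hEp := eventually_norm_modelKernel_sub_le hr0 hr1 hm0 hLp R hη
  have hEm := eventually_norm_modelKernel_sub_le hr0 hr1 hm0 hLm R hη
  have hχ : ∀ᶠ n : ℕ in atTop, ∀ ζ ∈ nthRootsFinset m (1 : ℂ), ∀ z a : ℂ, ‖z‖ ≤ 2 → ‖a‖ ≤ R →
      ‖(X ^ (m - 1) * θ ζ).eval (z + a / n) - (X ^ (m - 1) * θ ζ).eval z‖ ≤ η :=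
    (eventually_all_finset _).2 fun ζ _ => eventually_norm_eval_add_div_sub_le _ R hη
  have hpow := eventually_norm_eval_add_div_sub_le (X ^ m) R (sub_pos.2 hρs)
  obtain ⟨N, hN⟩ := eventually_atTop.1 (hEp.and (hEm.and (hχ.and (hpow.and
    (eventually_ge_atTop (d + 2 * m))))))
  refine ⟨N, fun n hn z₀ hz₀ a ha b hb => ?_⟩
  obtain ⟨hEp, hEm, hχ, hpow, hnd⟩ := hN n hn
  have hz := norm_pow_sub_one_eq_of_mem_frontier (hJG hz₀)
  have hz2 := norm_le_two hm0 (hz.le.trans hρ1.le)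
  have haR : ‖a‖ ≤ R := hR a (Or.inl ha)
  have hbR : ‖b‖ ≤ R := hR b (Or.inr hb)
  set n2 : ℝ := (n : ℝ) ^ 2 with hn2_def
  have hn2 : 0 ≤ n2 := sq_nonneg _
  set z := z₀ + a / (n : ℂ)
  set w := z₀ + b / (n : ℂ)
  have hnear : ∀ c : ℂ, ‖c‖ ≤ R → ‖(z₀ + c / n) ^ m - 1‖ ≤ s := by
    intro c hc
    have h1 := hpow z₀ c hz2 hc
    simp only [eval_pow, eval_X] at h1
    have h2 : (z₀ + c / n) ^ m - 1 = ((z₀ + c / n) ^ m - z₀ ^ m) + (z₀ ^ m - 1) := by ring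
    rw [h2]
    refine (norm_add_le _ _).trans ?_
    rw [hz]
    linarith
  have hsize : ∀ (E : ℂ) (c c' : ℂ), ‖c‖ ≤ R → ‖c'‖ ≤ R →
      ‖E - (n : ℂ) ^ 2 * H (A r m z₀ c c') *
        ((‖z₀‖ ^ (2 * m - 2) / (2 * Real.pi * r ^ (2 * m)) : ℝ) : ℂ)‖ ≤ η * n2 →
      ‖E‖ ≤ (B + 1) * n2 := by
    intro E c c' hc hc' h
    have h1 : ‖(n : ℂ) ^ 2 * H (A r m z₀ c c') *
        ((‖z₀‖ ^ (2 * m - 2) / (2 * Real.pi * r ^ (2 * m)) : ℝ) : ℂ)‖ ≤ n2 * B := by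
      rw [mul_assoc, norm_mul, norm_pow, Complex.norm_natCast]
      exact mul_le_mul_of_nonneg_left (hB z₀ c c' hz hc hc') hn2
    have h2 := norm_le_norm_add_norm_sub' E ((n : ℂ) ^ 2 * H (A r m z₀ c c') *
        ((‖z₀‖ ^ (2 * m - 2) / (2 * Real.pi * r ^ (2 * m)) : ℝ) : ℂ))
    have h3 : η * n2 ≤ 1 * n2 := by gcongr
    linarith
  have hEnonneg : ∀ (L : ℕ) (x : ℂ), 0 ≤ (modelKernel (r ^ m) m L x x).re := fun L x => by
    rw [modelKernel_self_re]
    exact mul_nonneg (sq_nonneg _) (diskKernel_self_re_nonneg _ _ _)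
  have hKdiag : ∀ c : ℂ, ‖c‖ ≤ R →
      (OrthPoly.kernel (areaMeasure r m) n (z₀ + c / n) (z₀ + c / n)).re ≤ (1 + κ * η) *
        (modelKernel (r ^ m) m ((n + d) / m + 1) (z₀ + c / n) (z₀ + c / n)).re := fun c hc =>
    le_of_mul_one_sub_sq_le hm1 hη.le hmη (hEnonneg _ _)
      (kernel_self_le hr0 hr1 hm0 hη.le (by linarith) hρs.le hs1 hd hθ n (hnear c hc))
  -- The comparison polynomial on the sheet of `z₀`.
  have hζ := branch_pow hm0 (hz.le.trans_lt hρ1)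
  set ζ := branch m z₀ with hζ_def
  obtain ⟨P, hPdeg, hPeval, hPint⟩ := exists_polynomial_near_modelKernel hr0 hr1 hm0 hη.le hζ
    (fun x hx => hθ ζ hζ x (hx.trans hρs.le)) ((n - (d + 2 * m)) / m) w
  have hPn : P.natDegree ≤ n := by
    have h1 := hd ζ hζ
    have h2 : m * ((n - (d + 2 * m)) / m - 1) ≤ n - (d + 2 * m) :=
      (Nat.mul_le_mul_left m (Nat.sub_le _ _)).trans (Nat.mul_div_le _ _)
    omega
  have hχnear : ∀ c : ℂ, ‖c‖ ≤ R →
      ‖(z₀ + c / n) ^ (m - 1) * (θ ζ).eval (z₀ + c / n) - 1‖ ≤ 2 * η := by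
    intro c hc
    have h1 := hχ ζ (hmem ζ hζ) z₀ c hz2 hc
    have h2 := hθ ζ hζ z₀ (hz.le.trans hρs.le)
    rw [if_pos rfl] at h2
    simp only [eval_mul, eval_pow, eval_X] at h1
    refine (norm_sub_le_norm_sub_add_norm_sub _ (z₀ ^ (m - 1) * (θ ζ).eval z₀) _).trans ?_
    linarith
  set Emw := (modelKernel (r ^ m) m ((n - (d + 2 * m)) / m) w w).re with hEmw
  have hEmwB : Emw ≤ (B + 1) * n2 :=
    (Complex.re_le_norm _).trans (hsize _ b b hbR hbR (hEm z₀ b b hz hbR hbR))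
  have hPw : (1 - 2 * η) * Emw ≤ (P.eval w).re := by
    have h1 : modelKernel (r ^ m) m ((n - (d + 2 * m)) / m) w w = (Emw : ℂ) := by
      rw [hEmw, modelKernel_self, Complex.ofReal_re]
    rw [hPeval, h1, Complex.re_mul_ofReal]
    have h2 := (Complex.abs_re_le_norm _).trans (hχnear b hbR)
    rw [Complex.sub_re, Complex.one_re, abs_le] at h2
    exact mul_le_mul_of_nonneg_right (by linarith) (hEnonneg _ _)
  have hI : ∫ x, ‖P.eval x‖ ^ 2 ∂(areaMeasure r m) ≤ (1 + 3 * η) * Emw := by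
    refine hPint.trans (mul_le_mul_of_nonneg_right ?_ (hEnonneg _ _))
    nlinarith
  have hre : ∀ E t : ℂ, ‖E - t‖ ≤ η * n2 → E.re ≤ t.re + η * n2 ∧ t.re - η * n2 ≤ E.re := by
    intro E t h
    have h1 := (Complex.abs_re_le_norm _).trans h
    rw [Complex.sub_re, abs_le] at h1
    constructor <;> linarith
  have hgap := sub_add_le_of_near hκ hη.le hB0 hn2 (hKdiag b hbR)
    (hre _ _ (hEp z₀ b b hz hbR hbR)).1 (hre _ _ (hEm z₀ b b hz hbR hbR)).2
    ((Complex.re_le_norm _).trans (hsize _ b b hbR hbR (hEp z₀ b b hz hbR hbR))) hEmwB hPw hI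
  have hKz : (OrthPoly.kernel (areaMeasure r m) n z z).re ≤ ((1 + κ) * (B + 1)) * n2 := by
    have h1 : (modelKernel (r ^ m) m ((n + d) / m + 1) z z).re ≤ (B + 1) * n2 :=
      (Complex.re_le_norm _).trans (hsize _ a a haR haR (hEp z₀ a a hz haR haR))
    have h2 : 1 + κ * η ≤ 1 + κ := by nlinarith
    calc _ ≤ (1 + κ * η) * _ := hKdiag a haR
      _ ≤ (1 + κ) * ((B + 1) * n2) := mul_le_mul h2 h1 (hEnonneg _ _) (by positivity)
      _ = _ := by ring
  have hcomp := OrthPoly.norm_sq_kernel_sub_eval_le (isCompact_closedBall (0 : ℂ) 2)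
    (areaMeasure_compl_closedBall hr0 hr1 hm0) (areaMeasure_compl_finite_ne_zero hr0 m) hPn z w
  have h1 : ‖OrthPoly.kernel (areaMeasure r m) n z w - P.eval z‖ ≤ ε / 2 * n2 := by
    refine le_of_sq_le_sq ?_ (by positivity)
    calc _ ≤ _ := hcomp
      _ ≤ (OrthPoly.kernel (areaMeasure r m) n z z).re * ((κ + 9) * (B + 1) * η * n2) :=
        mul_le_mul_of_nonneg_left hgap (OrthPoly.kernel_self_re_nonneg _ _ _)
      _ ≤ ((1 + κ) * (B + 1)) * n2 * ((κ + 9) * (B + 1) * η * n2) :=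
        mul_le_mul_of_nonneg_right hKz (by positivity)
      _ = ((1 + κ) * (B + 1)) * ((κ + 9) * (B + 1) * η) * n2 ^ 2 := by ring
      _ ≤ (ε / 2) ^ 2 * n2 ^ 2 := mul_le_mul_of_nonneg_right hη2 (sq_nonneg _)
      _ = _ := by ring
  have h2 : ‖P.eval z - modelKernel (r ^ m) m ((n - (d + 2 * m)) / m) z w‖
      ≤ 2 * η * ((B + 1) * n2) := by
    rw [hPeval, ← sub_one_mul, norm_mul]
    exact mul_le_mul (hχnear a haR) (hsize _ a b haR hbR (hEm z₀ a b hz haR hbR))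
      (norm_nonneg _) (by positivity)
  have h3 := hEm z₀ a b hz haR hbR
  calc _ ≤ _ := norm_sub_le_norm_sub_add_norm_sub _ (P.eval z) _
    _ ≤ ε / 2 * n2 + (2 * η * ((B + 1) * n2) + η * n2) :=
      add_le_add h1 ((norm_sub_le_norm_sub_add_norm_sub _
        (modelKernel (r ^ m) m ((n - (d + 2 * m)) / m) z w) _).trans (add_le_add h2 h3))
    _ = (ε / 2 + (2 * η * (B + 1) + η)) * n2 := by ring
    _ ≤ (ε / 2 + ε / 2) * n2 := by gcongr
    _ = _ := by ring
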